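/- **Theorem (Carlsson–Weinshall duality).** Work over $\mathbf C$. For integers $m,n\ge 0$ define the image formation correspondence as the Zariski closure $$\Gamma^{m,n}_{\mathbf A,\mathbf q,\mathbf p}=\overline{\{(\mathbf A,\mathbf q,\mathbf p)\in(\mathbf P^{11})^m\times(\mathbf P^3)^n\times(\mathbf P^2)^{mn} \mid A_iq_j\sim p_{ij}\ \ \forall i\in[m],\,j\in[n]\}},$$ where $\mathbf P^{11}$ is the projective space of $3\times4$ matrices and $v\sim p$ means that $v$ is nonzero and represents the point $p$. For $a=[a_1:a_2:a_3:a_4]\in\mathbf P^3$ let $$A(a)=\begin{bmatrix}a_1&0&0&a_4\\0&a_2&0&a_4\\0&0&a_3&a_4\end{bmatrix},$$ and define the reduced image formation correspondence as the Zariski closure $$\mathrm P^{m,n}_{\mathbf a,\mathbf q,\mathbf p}=\overline{\{(\mathbf a,\mathbf q,\mathbf p)\in(\mathbf P^3)^m\times(\mathbf P^3)^n\times(\mathbf P^2)^{mn}\mid A(a_i)q_j\sim p_{ij}\ \ \forall i,j\}}.$$ Let $E_5=[1:1:1:1]$ and let $\mathcal G_m=(\mathrm{PGL}_3)^m\times\mathrm{Stab}_{\mathrm{PGL}_4}(E_5)$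 act on $\Gamma^{m,n}_{\mathbf A,\mathbf q,\mathbf p}$ by $$(T_1,\dots,T_m,S)\cdot(\mathbf A,\mathbf q,\mathbf p)=\big((T_iA_iS^{-1})_i,\ (Sq_j)_j,\ (T_ip_{ij})_{i,j}\big).$$ For all $m,n\ge0$, the sets $\Gamma^{m,n+4}_{\mathbf A,\mathbf q,\mathbf p}$, $\mathrm P^{m,n}_{\mathbf a,\mathbf q,\mathbf p}$ and $\mathcal G_m$ are irreducible varieties, and there are birational equivalences $$\Phi_{m,n}:\ \Gamma^{m,n+4}_{\mathbf A,\mathbf q,\mathbf p}\dashrightarrow \mathrm P^{m,n}_{\mathbf a,\mathbf q,\mathbf p}\times\mathcal G_m$$ and birational maps $\nu^{\mathrm{top}}_{m,n}$ such that the diagram $$\begin{array}{ccc} \Gamma^{m,n+4}_{\mathbf A,\mathbf q,\mathbf p}\times(\mathrm{PGL}_3)^n & \overset{\nu^{\mathrm{top}}_{m,n}}{\dashrightarrow} & \Gamma^{n,m+4}_{\mathbf A,\mathbf q,\mathbf p}\times(\mathrm{PGL}_3)^m\\ {\scriptstyle \Phi_{m,n}\times\mathrm{id}}\ \downarrow &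 & \downarrow\ {\scriptstyle \Phi_{n,m}\times\mathrm{id}}\\ (\mathrm P^{m,n}_{\mathbf a,\mathbf q,\mathbf p}\times\mathcal G_m)\times(\mathrm{PGL}_3)^n & \overset{\nu^{\mathrm{mid}}_{m,n}}{\longrightarrow} & (\mathrm P^{n,m}_{\mathbf a,\mathbf q,\mathbf p}\times\mathcal G_n)\times(\mathrm{PGL}_3)^m\\ \downarrow & & \downarrow\\ \mathrm P^{m,n}_{\mathbf a,\mathbf q,\mathbf p} & \overset{\nu_{m,n}}{\longrightarrow} & \mathrm P^{n,m}_{\mathbf a,\mathbf q,\mathbf p} \end{array}$$ commutes, where $\nu_{m,n}(\mathbf a,\mathbf q,(p_{ij})_{i,j})=(\mathbf q,\mathbf a,(p_{ij})_{j,i})$ is a biregular isomorphism, $\nu^{\mathrm{mid}}_{m,n}\big((y,(T,S)),T'\big)=\big((\nu_{m,n}(y),(T',S)),T\big)$ is birational, the upper vertical maps are birational, and the lower vertical maps are the projections. Moreover: 1. If $\nu_{m,n}$ denotes any of the horizontal maps, then $\nu_{n,m}\circ\nu_{m,n}=\mathrm{id}$ wherever both maps are defined. 2. $\mathcal G_m$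 is an algebraic group that acts rationally on $\Gamma^{m,n+4}_{\mathbf A,\mathbf q,\mathbf p}$, and the composite $\Gamma^{m,n+4}_{\mathbf A,\mathbf q,\mathbf p}\dashrightarrow\mathrm P^{m,n}_{\mathbf a,\mathbf q,\mathbf p}\times\mathcal G_m\to\mathrm P^{m,n}_{\mathbf a,\mathbf q,\mathbf p}$ of $\Phi_{m,n}$ with the projection is a rational quotient: composition with it is an isomorphism of $\mathbf C$-algebras from $\mathbf C(\mathrm P^{m,n}_{\mathbf a,\mathbf q,\mathbf p})$ onto the field $\mathbf C(\Gamma^{m,n+4}_{\mathbf A,\mathbf q,\mathbf p})^{\mathcal G_m}$ of $\mathcal G_m$-invariant rational functions. 3. Let $\pi'_{\mathbf a}$ and $\pi'_{\mathbf q}$ denote the projections from the reduced correspondences that forget the factors $\mathbf a$ and $\mathbf q$. Then, with $(\mathbf P^2)^{mn}$ and $(\mathbf P^2)^{nm}$ identified by transposing indices, $\pi'_{\mathbf q}\circ\nu_{m,n}=\pi'_{\mathbf a}$ and $\pi'_{\mathbf a}\circ\nu_{m,n}=\pi'_{\mathbf q}$ on $\mathrm P^{m,n}_{\mathbf a,\mathbf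 q,\mathbf p}$. -/

import Mathlib

open Filter Set Topology
open scoped LinearAlgebra.Projectivization Matrix

noncomputable section

namespace CW

/-! ### Multiprojective spaces and the Zariski topology -/

/-- `M` is a finite product of complex projective spaces, with homogeneous coordinates indexed by
`Coord`; the coordinate `c` belongs to the factor `grp c`, and `rep x` is a choice of homogeneous
coordinates of the point `x`.  The two laws say that `M` is exactly the set of vectors that are
nonzero in every factor, up to rescaling each factor. -/
class MultiProj (M : Type) where
  Idx : Type
  Coord : Type
  finite_coord : Finite Coord
  grp : Coord → Idx
  rep : M → Coord → ℂ
  rep_ne_zero : ∀ (x : M) (i : Idx), ∃ c, grp c = i ∧ rep x c ≠ 0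
  existsUnique_point : ∀ v : Coord → ℂ, (∀ i, ∃ c, grp c = i ∧ v c ≠ 0) →
    ∃! x : M, ∃ t : Idx → ℂˣ, ∀ c, v c = t (grp c) * rep x c

open MultiProj

/-- Projective space with homogeneous coordinates indexed by `κ`, through an identification `e` of
the underlying vector space with `κ → ℂ`. -/
abbrev MultiProj.ofEquiv {V κ : Type} [AddCommGroup V] [Module ℂ V] [Finite κ]
    (e : V ≃ₗ[ℂ] (κ → ℂ)) : MultiProj (ℙ ℂ V) where
  Idx := Unit
  Coord := κ
  finite_coord := inferInstance
  grp _ := ()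
  rep x := e x.rep
  rep_ne_zero x i := by
    have h : e x.rep ≠ 0 := by simpa using x.rep_nonzero
    obtain ⟨c, hc⟩ := Function.ne_iff.mp h
    exact ⟨c, rfl, hc⟩
  existsUnique_point v hv := by
    obtain ⟨c, -, hc⟩ := hv ()
    have hv0 : e.symm v ≠ 0 := by
      intro h
      apply hc
      have : v = 0 := by simpa using h
      simp [this]
    refine ⟨Projectivization.mk ℂ (e.symm v) hv0, ?_, ?_⟩
    · obtain ⟨a, ha⟩ := Projectivization.exists_smul_eq_mk_rep ℂ (e.symm v) hv0
      refine ⟨fun _ => a⁻¹, fun c => ?_⟩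
      have h2 : v = (a⁻¹ : ℂˣ) • e (Projectivization.mk ℂ (e.symm v) hv0).rep := by
        rw [← ha, Units.smul_def, Units.smul_def, map_smul, smul_smul]
        simp
      exact congrFun h2 c
    · rintro y ⟨t, ht⟩
      rw [← Projectivization.mk_rep y, Projectivization.mk_eq_mk_iff]
      refine ⟨(t ())⁻¹, ?_⟩
      have h2 : v = (t () : ℂ) • e y.rep := funext ht
      rw [h2, map_smul, Units.smul_def, smul_smul]
      simp

instance instMultiProjVec (k : ℕ) : MultiProj (ℙ ℂ (Fin k → ℂ)) :=
  MultiProj.ofEquiv (LinearEquiv.refl ℂ _)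

instance instMultiProjMat (k l : ℕ) : MultiProj (ℙ ℂ (Matrix (Fin k) (Fin l) ℂ)) :=
  MultiProj.ofEquiv (LinearEquiv.curry ℂ ℂ (Fin k) (Fin l)).symm

instance instMultiProjProd (M N : Type) [MultiProj M] [MultiProj N] : MultiProj (M × N) where
  Idx := Idx M ⊕ Idx N
  Coord := Coord M ⊕ Coord N
  finite_coord := by
    have := finite_coord (M := M)
    have := finite_coord (M := N)
    infer_instance
  grp := Sum.map grp grp
  rep x := Sum.elim (rep x.1) (rep x.2)
  rep_ne_zero := by
    rintro x (i | i)
    · obtain ⟨c, hc, h⟩ := rep_ne_zero x.1 i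
      exact ⟨Sum.inl c, by simp [hc], h⟩
    · obtain ⟨c, hc, h⟩ := rep_ne_zero x.2 i
      exact ⟨Sum.inr c, by simp [hc], h⟩
  existsUnique_point v hv := by
    obtain ⟨x, ⟨t, ht⟩, hx⟩ := existsUnique_point (M := M) (fun c => v (Sum.inl c)) (fun i => by
      obtain ⟨c | c, hc, h⟩ := hv (Sum.inl i)
      · exact ⟨c, by simpa using hc, h⟩
      · simp at hc)
    obtain ⟨y, ⟨s, hs⟩, hy⟩ := existsUnique_point (M := N) (fun c => v (Sum.inr c)) (fun i => by
      obtain ⟨c | c, hc, h⟩ := hv (Sum.inr i)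
      · simp at hc
      · exact ⟨c, by simpa using hc, h⟩)
    refine ⟨(x, y), ⟨Sum.elim t s, ?_⟩, ?_⟩
    · rintro (c | c)
      · exact ht c
      · exact hs c
    · rintro ⟨x', y'⟩ ⟨r, hr⟩
      refine Prod.ext (hx x' ⟨fun i => r (Sum.inl i), fun c => hr (Sum.inl c)⟩)
        (hy y' ⟨fun i => r (Sum.inr i), fun c => hr (Sum.inr c)⟩)

instance instMultiProjPi (k : ℕ) (M : Type) [MultiProj M] : MultiProj (Fin k → M) where
  Idx := Fin k × Idx M
  Coord := Fin k × Coord M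
  finite_coord := by
    have := finite_coord (M := M)
    infer_instance
  grp c := (c.1, grp c.2)
  rep x c := rep (x c.1) c.2
  rep_ne_zero := by
    rintro x ⟨j, i⟩
    obtain ⟨c, hc, h⟩ := rep_ne_zero (x j) i
    exact ⟨(j, c), by simp [hc], h⟩
  existsUnique_point v hv := by
    have key : ∀ j : Fin k, ∃! x : M, ∃ t : Idx M → ℂˣ, ∀ c, v (j, c) = t (grp c) * rep x c :=
      fun j => existsUnique_point (M := M) (fun c => v (j, c)) (fun i => by
        obtain ⟨⟨j', c⟩, hc, h⟩ := hv (j, i)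
        obtain ⟨rfl, h2⟩ := Prod.mk.inj hc
        exact ⟨c, h2, h⟩)
    choose x hx hu using key
    choose t ht using hx
    refine ⟨x, ⟨fun i => t i.1 i.2, fun c => ht c.1 c.2⟩, ?_⟩
    rintro y ⟨r, hr⟩
    funext j
    exact hu j (y j) ⟨fun i => r (j, i), fun c => hr (j, c)⟩

section Varieties

variable {M N : Type} [MultiProj M] [MultiProj N]

/-- `F` is multihomogeneous of multidegree `d` in the homogeneous coordinates of `M`. -/
def IsMultiHom (M : Type) [MultiProj M] (F : MvPolynomial (Coord M) ℂ) (d : Idx M →₀ ℕ) : Prop :=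
  MvPolynomial.IsWeightedHomogeneous (fun c => Finsupp.single (grp c) 1) F d

/-- The value of `F` at the chosen homogeneous coordinates of `x`. -/
def evalAt (F : MvPolynomial (Coord M) ℂ) (x : M) : ℂ := MvPolynomial.eval (rep x) F

/-- The Zariski topology: generated by the nonvanishing loci of multihomogeneous polynomials. -/
def zariski (M : Type) [MultiProj M] : TopologicalSpace M :=
  TopologicalSpace.generateFrom
    {U | ∃ (F : MvPolynomial (Coord M) ℂ) (d : Idx M →₀ ℕ),
      IsMultiHom M F d ∧ U = {x | evalAt F x ≠ 0}}

/-- The Zariski closure of a subset. -/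
def zclosure (S : Set M) : Set M := @closure M (zariski M) S

/-- An (irreducible, quasi-projective) variety: an irreducible locally closed subset of a
multiprojective space. -/
def IsVariety (X : Set M) : Prop :=
  @IsLocallyClosed M (zariski M) X ∧ @IsIrreducible M (zariski M) X

/-- `U` is a dense open subset of `X`, in the Zariski topology of `X`. -/
def IsDenseOpenIn (X U : Set M) : Prop :=
  (∃ O : Set M, IsOpen[zariski M] O ∧ U = X ∩ O) ∧ X ⊆ zclosure U

lemma isDenseOpenIn_self (X : Set M) : IsDenseOpenIn X X :=
  ⟨⟨univ, @isOpen_univ M (zariski M), by simp⟩, @subset_closure M (zariski M) X⟩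

lemma IsDenseOpenIn.inter {X U V : Set M} (hU : IsDenseOpenIn X U) (hV : IsDenseOpenIn X V) :
    IsDenseOpenIn X (U ∩ V) := by
  letI := zariski M
  obtain ⟨⟨O, hO, rfl⟩, hU⟩ := hU
  obtain ⟨⟨O', hO', rfl⟩, hV⟩ := hV
  refine ⟨⟨O ∩ O', hO.inter hO', by ext; simp; tauto⟩, fun x hx => ?_⟩
  change x ∈ closure _
  rw [mem_closure_iff]
  intro W hW hxW
  obtain ⟨y, hyW, hyX, hyO⟩ := mem_closure_iff.mp (hU hx) W hW hxW
  obtain ⟨z, ⟨hzW, hzO⟩, hzX, hzO'⟩ := mem_closure_iff.mp (hV hyX) (W ∩ O) (hW.inter hO) ⟨hyW, hyO⟩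
  exact ⟨z, hzW, ⟨hzX, hzO⟩, hzX, hzO'⟩

/-- The filter of sets that contain a dense open subset of `X`: `∀ᶠ x in gen X, p x` says that `p`
holds at every point of some dense open subset of `X`. -/
def gen (X : Set M) : Filter M where
  sets := {S | ∃ U, IsDenseOpenIn X U ∧ U ⊆ S}
  univ_sets := ⟨X, isDenseOpenIn_self X, subset_univ X⟩
  sets_of_superset := fun ⟨U, hU, h⟩ hS => ⟨U, hU, h.trans hS⟩
  inter_sets := fun ⟨U, hU, h⟩ ⟨V, hV, h'⟩ => ⟨U ∩ V, hU.inter hV, inter_subset_inter h h'⟩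

/-! ### Regular functions, rational functions, regular and rational maps -/

/-- On `U`, the function `f` is locally a quotient of two multihomogeneous polynomials of the same
multidegree. -/
def IsRegularFunOn (U : Set M) (f : M → ℂ) : Prop :=
  ∀ x ∈ U, ∃ O : Set M, IsOpen[zariski M] O ∧ x ∈ O ∧
    ∃ (F G : MvPolynomial (Coord M) ℂ) (d : Idx M →₀ ℕ), IsMultiHom M F d ∧ IsMultiHom M G d ∧
      ∀ y ∈ U ∩ O, evalAt G y ≠ 0 ∧ f y = evalAt F y / evalAt G y

/-- On `U`, the map `f` is locally given in homogeneous coordinates by polynomials: for every factor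
of the target a tuple of multihomogeneous polynomials of one multidegree, without common zero. -/
def IsRegularMapOn (U : Set M) (f : M → N) : Prop :=
  ∀ x ∈ U, ∃ O : Set M, IsOpen[zariski M] O ∧ x ∈ O ∧
    ∃ (F : Coord N → MvPolynomial (Coord M) ℂ) (d : Idx N → (Idx M →₀ ℕ)),
      (∀ c, IsMultiHom M (F c) (d (grp c))) ∧
      ∀ y ∈ U ∩ O, ∃ t : Idx N → ℂˣ, ∀ c, evalAt (F c) y = t (grp c) * rep (f y) c

/-- A morphism of varieties `X → Y`. -/
def IsMorphism (X : Set M) (Y : Set N) (f : M → N) : Prop :=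
  MapsTo f X Y ∧ IsRegularMapOn X f

/-- A biregular isomorphism `X → Y`. -/
def IsBiregular (X : Set M) (Y : Set N) (f : M → N) : Prop :=
  IsMorphism X Y f ∧ ∃ g : N → M, IsMorphism Y X g ∧ InvOn g f X Y

/-- A rational map from `X` to `Y`, represented by a function that is a regular map to `Y` on a dense
open subset of `X`; its other values are irrelevant.  Two such functions are the same rational
map iff they agree on a dense open subset of `X`, that is, if `f =ᶠ[gen X] g`. -/
def IsRationalMap (X : Set M) (Y : Set N) (f : M → N) : Prop :=
  ∃ U, IsDenseOpenIn X U ∧ MapsTo f U Y ∧ IsRegularMapOn U f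

/-- A rational map for which the preimage of every dense open set contains a dense open set, so that
rational functions and maps on `Y` can be composed with it. -/
def IsDominantRationalMap (X : Set M) (Y : Set N) (f : M → N) : Prop :=
  IsRationalMap X Y f ∧ Tendsto f (gen X) (gen Y)

/-- A birational equivalence from `X` to `Y`. -/
def IsBirational (X : Set M) (Y : Set N) (f : M → N) : Prop :=
  IsDominantRationalMap X Y f ∧ ∃ g : N → M, IsDominantRationalMap Y X g ∧
    (∀ᶠ x in gen X, g (f x) = x) ∧ (∀ᶠ y in gen Y, f (g y) = y)

/-- On an open neighborhood of `x` in `X`, the function `f` is a regular map to `Y`. -/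
def IsDefinedAt (X : Set M) (Y : Set N) (f : M → N) (x : M) : Prop :=
  ∃ O : Set M, IsOpen[zariski M] O ∧ x ∈ O ∧ IsMorphism (X ∩ O) Y f

/-- The composite of the rational maps `f` from `X` to `Y` and `g` from `Y` to `X` is the identity at
each point where both maps are defined, whatever the functions that represent them. -/
def CompEqIdWhereDefined (X : Set M) (Y : Set N) (f : M → N) (g : N → M) : Prop :=
  ∀ (f' : M → N) (g' : N → M), f' =ᶠ[gen X] f → g' =ᶠ[gen Y] g →
    ∀ x ∈ X, IsDefinedAt X Y f' x → IsDefinedAt Y X g' (f' x) → g' (f' x) = x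

instance instAlgebraGerm {α : Type} (l : Filter α) : Algebra ℂ (Germ l ℂ) :=
  Algebra.ofModule
    (fun r x y => by
      induction x using Germ.inductionOn
      induction y using Germ.inductionOn
      simp only [← Germ.coe_smul, ← Germ.coe_mul, smul_mul_assoc])
    (fun r x y => by
      induction x using Germ.inductionOn
      induction y using Germ.inductionOn
      simp only [← Germ.coe_smul, ← Germ.coe_mul, mul_smul_comm])

lemma germ_algebraMap {α : Type} (l : Filter α) (r : ℂ) :
    algebraMap ℂ (Germ l ℂ) r = ((fun _ => r : α → ℂ) : Germ l ℂ) := by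
  rw [Algebra.algebraMap_eq_smul_one, ← Germ.coe_one, ← Germ.coe_smul]
  congr 1
  funext
  simp

lemma IsRegularFunOn.mono {U V : Set M} {f : M → ℂ} (hf : IsRegularFunOn V f) (h : U ⊆ V) :
    IsRegularFunOn U f := fun x hx => by
  obtain ⟨O, hO, hxO, F, G, d, hF, hG, H⟩ := hf x (h hx)
  exact ⟨O, hO, hxO, F, G, d, hF, hG, fun y hy => H y ⟨h hy.1, hy.2⟩⟩

lemma IsRegularFunOn.const (U : Set M) (r : ℂ) : IsRegularFunOn U (fun _ => r) := fun _ _ =>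
  ⟨univ, @isOpen_univ M (zariski M), trivial, MvPolynomial.C r, 1, 0,
    MvPolynomial.isWeightedHomogeneous_C _ r, MvPolynomial.isWeightedHomogeneous_one _ _,
    fun y _ => by simp [evalAt]⟩

lemma IsRegularFunOn.add {U : Set M} {f g : M → ℂ} (hf : IsRegularFunOn U f)
    (hg : IsRegularFunOn U g) : IsRegularFunOn U (f + g) := fun x hx => by
  obtain ⟨O, hO, hxO, F, G, d, hF, hG, H⟩ := hf x hx
  obtain ⟨O', hO', hxO', F', G', d', hF', hG', H'⟩ := hg x hx
  refine ⟨O ∩ O', @IsOpen.inter M (zariski M) _ _ hO hO', ⟨hxO, hxO'⟩, F * G' + G * F', G * G',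
    d + d', (hF.mul hG').add (hG.mul hF'), hG.mul hG', fun y hy => ?_⟩
  obtain ⟨h1, h2⟩ := H y ⟨hy.1, hy.2.1⟩
  obtain ⟨h1', h2'⟩ := H' y ⟨hy.1, hy.2.2⟩
  simp only [evalAt, map_mul, map_add, Pi.add_apply] at *
  exact ⟨mul_ne_zero h1 h1', by rw [h2, h2', div_add_div _ _ h1 h1']⟩

lemma IsRegularFunOn.mul {U : Set M} {f g : M → ℂ} (hf : IsRegularFunOn U f)
    (hg : IsRegularFunOn U g) : IsRegularFunOn U (f * g) := fun x hx => by
  obtain ⟨O, hO, hxO, F, G, d, hF, hG, H⟩ := hf x hx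
  obtain ⟨O', hO', hxO', F', G', d', hF', hG', H'⟩ := hg x hx
  refine ⟨O ∩ O', @IsOpen.inter M (zariski M) _ _ hO hO', ⟨hxO, hxO'⟩, F * F', G * G',
    d + d', hF.mul hF', hG.mul hG', fun y hy => ?_⟩
  obtain ⟨h1, h2⟩ := H y ⟨hy.1, hy.2.1⟩
  obtain ⟨h1', h2'⟩ := H' y ⟨hy.1, hy.2.2⟩
  simp only [evalAt, map_mul, Pi.mul_apply] at *
  exact ⟨mul_ne_zero h1 h1', by rw [h2, h2', div_mul_div_comm]⟩

/-- The function field `ℂ(X)`: functions that are regular on a dense open subset of `X`, up to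
agreement on a dense open subset. -/
def RatFun (X : Set M) : Subalgebra ℂ (Germ (gen X) ℂ) where
  carrier := {h | ∃ (f : M → ℂ) (U : Set M),
    h = (f : Germ (gen X) ℂ) ∧ IsDenseOpenIn X U ∧ IsRegularFunOn U f}
  mul_mem' := by
    rintro _ _ ⟨f, U, rfl, hU, hf⟩ ⟨g, V, rfl, hV, hg⟩
    exact ⟨f * g, U ∩ V, rfl, hU.inter hV,
      (hf.mono inter_subset_left).mul (hg.mono inter_subset_right)⟩
  add_mem' := by
    rintro _ _ ⟨f, U, rfl, hU, hf⟩ ⟨g, V, rfl, hV, hg⟩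
    exact ⟨f + g, U ∩ V, rfl, hU.inter hV,
      (hf.mono inter_subset_left).add (hg.mono inter_subset_right)⟩
  algebraMap_mem' r :=
    ⟨fun _ => r, X, germ_algebraMap _ r, isDenseOpenIn_self X, IsRegularFunOn.const X r⟩

end Varieties

/-! ### Algebraic groups, rational actions, rational quotients -/

section Quotients

variable {H M N : Type} [MultiProj H] [MultiProj M] [MultiProj N]

/-- `G` is an algebraic group: a locally closed subset of a multiprojective space with a group
structure whose multiplication and inversion are morphisms. -/
structure IsAlgebraicGroup (G : Set H) (mul : H → H → H) (inv : H → H) (one : H) : Prop where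
  locallyClosed : @IsLocallyClosed H (zariski H) G
  mul_morphism : IsMorphism (G ×ˢ G) G (fun x => mul x.1 x.2)
  inv_morphism : IsMorphism G G inv
  one_mem : one ∈ G
  mul_assoc : ∀ a ∈ G, ∀ b ∈ G, ∀ c ∈ G, mul (mul a b) c = mul a (mul b c)
  one_mul : ∀ a ∈ G, mul one a = a
  inv_mul : ∀ a ∈ G, mul (inv a) a = one

/-- `G` acts rationally on `X`: the action is a rational map from `G × X` to `X`, and it is a
homomorphism from `G` to the group of birational self-maps of `X`. -/
structure IsRationalAction (G : Set H) (mul : H → H → H) (one : H) (X : Set M)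
    (act : H → M → M) : Prop where
  rational : IsRationalMap (G ×ˢ X) X (fun x => act x.1 x.2)
  birational : ∀ g ∈ G, IsBirational X X (act g)
  one_act : ∀ᶠ x in gen X, act one x = x
  mul_act : ∀ g ∈ G, ∀ h ∈ G, ∀ᶠ x in gen X, act (mul g h) x = act g (act h x)

/-- The `G`-invariant rational functions on `X`. -/
def Invariants (G : Set H) (X : Set M) (act : H → M → M) : Subalgebra ℂ (Germ (gen X) ℂ) where
  carrier := {h | h ∈ RatFun X ∧ ∃ f : M → ℂ, h = (f : Germ (gen X) ℂ) ∧
    ∀ g ∈ G, ∀ᶠ x in gen X, f (act g x) = f x}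
  mul_mem' := by
    rintro _ _ ⟨h, f, rfl, hf⟩ ⟨h', f', rfl, hf'⟩
    refine ⟨mul_mem h h', f * f', rfl, fun g hg => ?_⟩
    filter_upwards [hf g hg, hf' g hg] with x hx hx'
    simp [hx, hx']
  add_mem' := by
    rintro _ _ ⟨h, f, rfl, hf⟩ ⟨h', f', rfl, hf'⟩
    refine ⟨add_mem h h', f + f', rfl, fun g hg => ?_⟩
    filter_upwards [hf g hg, hf' g hg] with x hx hx'
    simp [hx, hx']
  algebraMap_mem' r :=
    ⟨algebraMap_mem _ r, fun _ => r, germ_algebraMap _ r, fun _ _ => Eventually.of_forall fun _ => rfl⟩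

/-- The rational map `φ` from `X` to `Y` makes the variety `Y` a rational quotient of the variety `X`
by the algebraic group `G`, which acts rationally on `X`: composition with `φ` is an isomorphism
from `ℂ(Y)` to the field `ℂ(X)^G` of invariant rational functions. -/
structure IsRationalQuotient (G : Set H) (mul : H → H → H) (inv : H → H) (one : H)
    (X : Set M) (act : H → M → M) (Y : Set N) (φ : M → N) : Prop where
  group : IsAlgebraicGroup G mul inv one
  variety_source : IsVariety X
  variety_target : IsVariety Y
  action : IsRationalAction G mul one X act
  rational : IsRationalMap X Y φ
  exists_equiv : ∃ (hφ : Tendsto φ (gen X) (gen Y)) (e : RatFun Y ≃ₐ[ℂ] Invariants G X act),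
    ∀ h : RatFun Y, (e h : Germ (gen X) ℂ) = (h : Germ (gen Y) ℂ).compTendsto φ hφ

end Quotients

/-! ### Cameras, points and image formation -/

/-- The projective plane. -/
abbrev P2 : Type := ℙ ℂ (Fin 3 → ℂ)

/-- Projective 3-space. -/
abbrev P3 : Type := ℙ ℂ (Fin 4 → ℂ)

/-- The projective space of `3 × 4` matrices. -/
abbrev P11 : Type := ℙ ℂ (Matrix (Fin 3) (Fin 4) ℂ)

/-- The projective space of `k × k` matrices. -/
abbrev PMat (k : ℕ) : Type := ℙ ℂ (Matrix (Fin k) (Fin k) ℂ)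

/-- The vector `v` is nonzero and represents the point `x`. -/
def Represents {V : Type} [AddCommGroup V] [Module ℂ V] (v : V) (x : ℙ ℂ V) : Prop :=
  ∃ hv : v ≠ 0, Projectivization.mk ℂ v hv = x

open Classical in
/-- The point `[v]`, with an arbitrary value for `v = 0`. -/
def toProj {V : Type} [AddCommGroup V] [Module ℂ V] [Nontrivial V] (v : V) : ℙ ℂ V :=
  if hv : v ≠ 0 then Projectivization.mk ℂ v hv else Classical.arbitrary _

/-- `(ℙ¹¹)^m × (ℙ³)^n × (ℙ²)^(mn)`, with elements `(A, q, p)`. -/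
abbrev Amb (m n : ℕ) : Type := (Fin m → P11) × (Fin n → P3) × (Fin m → Fin n → P2)

/-- `(ℙ³)^m × (ℙ³)^n × (ℙ²)^(mn)`, with elements `(a, q, p)`. -/
abbrev RAmb (m n : ℕ) : Type := (Fin m → P3) × (Fin n → P3) × (Fin m → Fin n → P2)

/-- The image formation correspondence. -/
def imageCorr (m n : ℕ) : Set (Amb m n) :=
  zclosure {x | ∀ i j, Represents ((x.1 i).rep *ᵥ (x.2.1 j).rep) (x.2.2 i j)}

/-- The `3 × 4` matrix `A(a)` attached to a vector `a`. -/
def redCam (a : Fin 4 → ℂ) : Matrix (Fin 3) (Fin 4) ℂ :=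
  !![a 0, 0, 0, a 3;
     0, a 1, 0, a 3;
     0, 0, a 2, a 3]

/-- The reduced image formation correspondence. -/
def redCorr (m n : ℕ) : Set (RAmb m n) :=
  zclosure {x | ∀ i j, Represents (redCam (x.1 i).rep *ᵥ (x.2.1 j).rep) (x.2.2 i j)}

/-! ### The group -/

/-- `PGL_k`, as the open set of classes of invertible matrices. -/
def PGL (k : ℕ) : Set (PMat k) := {T | T.rep.det ≠ 0}

/-- The product `(PGL_3)^n`. -/
def PGLPow (n : ℕ) : Set (Fin n → PMat 3) := {T | ∀ i, T i ∈ PGL 3}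

/-- The stabilizer in `PGL_4` of the point `E₅ = [1 : 1 : 1 : 1]`. -/
def stabE5 : Set (PMat 4) :=
  {S | S ∈ PGL 4 ∧ Represents (S.rep *ᵥ (fun _ => 1)) (toProj (fun _ => 1 : Fin 4 → ℂ))}

/-- The space that contains the group below. -/
abbrev GAmb (m : ℕ) : Type := (Fin m → PMat 3) × PMat 4

/-- `(PGL_3)^m × Stab(E₅)`. -/
def grpG (m : ℕ) : Set (GAmb m) := PGLPow m ×ˢ stabE5

/-- The product in `(PGL_3)^m × PGL_4`. -/
def mulG (m : ℕ) (g h : GAmb m) : GAmb m :=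
  (fun i => toProj ((g.1 i).rep * (h.1 i).rep), toProj (g.2.rep * h.2.rep))

/-- The inverse in `(PGL_3)^m × PGL_4`. -/
def invG (m : ℕ) (g : GAmb m) : GAmb m :=
  (fun i => toProj (g.1 i).rep⁻¹, toProj g.2.rep⁻¹)

/-- The neutral element of `(PGL_3)^m × PGL_4`. -/
def oneG (m : ℕ) : GAmb m := (fun _ => toProj 1, toProj 1)

/-- The action `(T, S) · (A, q, p) = (T_i A_i S⁻¹, S q_j, T_i p_ij)`. -/
def actG (m n : ℕ) (g : GAmb m) (x : Amb m n) : Amb m n :=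
  (fun i => toProj ((g.1 i).rep * (x.1 i).rep * g.2.rep⁻¹),
   fun j => toProj (g.2.rep *ᵥ (x.2.1 j).rep),
   fun i j => toProj ((g.1 i).rep *ᵥ (x.2.2 i j).rep))

/-! ### The duality maps -/

/-- The swap of cameras and points, `(a, q, p) ↦ (q, a, pᵀ)`. -/
def swapRed (m n : ℕ) (x : RAmb m n) : RAmb n m := (x.2.1, x.1, fun j i => x.2.2 i j)

/-- The swap `((y, (T, S)), T') ↦ ((swap of y, (T', S)), T)`. -/
def swapMid (m n : ℕ) (z : (RAmb m n × GAmb m) × (Fin n → PMat 3)) :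
    (RAmb n m × GAmb n) × (Fin m → PMat 3) :=
  ((swapRed m n z.1.1, (z.2, z.1.2.2)), z.1.2.1)

/-- The projection that forgets the cameras `a`. -/
def forgetA (m n : ℕ) (x : RAmb m n) : (Fin n → P3) × (Fin m → Fin n → P2) := x.2

/-- The projection that forgets the points `q`. -/
def forgetQ (m n : ℕ) (x : RAmb m n) : (Fin m → P3) × (Fin m → Fin n → P2) := (x.1, x.2.2)

/-- The identification of `(ℙ³)^k × (ℙ²)^(mn)` with `(ℙ³)^k × (ℙ²)^(nm)`. -/
def transposeImg (k m n : ℕ) (z : (Fin k → P3) × (Fin m → Fin n → P2)) :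
    (Fin k → P3) × (Fin n → Fin m → P2) := (z.1, fun j i => z.2 i j)

end CW

end

noncomputable section

namespace CW

open MultiProj

attribute [local instance 2000] zariski

/-! ### Multihomogeneous polynomials -/

section Forms

variable {M N K : Type} [MultiProj M] [MultiProj N] [MultiProj K]

/-! A generic configuration has a normal form. The last four points together with `E5` are in
general position in ℙ³, so exactly one class in PGL₄ carries the coordinate points and [1:1:1:1] to
them, and this class fixes `E5`. In each image the last four image points are in general position in
ℙ², which gives one class in PGL₃ per camera. Undoing this group element `frameElt x` puts the four
points and their images in standard position. A camera that sends e₁, e₂, e₃, e₄ to e₁, e₂, e₃,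
(1,1,1) up to scalars has the shape A(a) with all a_k ≠ 0 (`eq_redCam_camParam`), so what is left is
a point of the reduced correspondence. Hence `splitConf` and `joinConf` are mutually inverse regular
maps between `regularConf m n` and `regularRed m n ×ˢ grpG m`, and `isBirational_of_inverse` yields
Φ.

By uniqueness of frame matrices (`frameElt_actG`) the group acts in these coordinates by left
multiplication on the group factor. So the reduced configuration is invariant, two regular
configurations with the same reduction lie in one orbit, and freezing the group coordinate gives
sections; `isRationalQuotient_of_sections` turns this into a rational quotient.

The duality is the identity A(a)q = A(q)a (`redCam_mulVec_comm`): exchanging cameras and points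
preserves the reduced correspondence. The top map is this exchange conjugated by Φ.

The geometry underneath is elementary. Both correspondences are closures of graphs of regular maps
on open subsets of multiprojective spaces, hence irreducible, so nonempty relatively open subsets
are dense. In the closure, the graph is cut out by the open condition that all images are defined
(`isDenseOpenIn_graphSet`). -/

lemma IsMultiHom.eval_mul {F : MvPolynomial (Coord M) ℂ} {d : Idx M →₀ ℕ} (hF : IsMultiHom M F d)
    (t : Idx M → ℂ) (v : Coord M → ℂ) :
    MvPolynomial.eval (fun c => t (grp c) * v c) F =
      (d.prod fun i k => t i ^ k) * MvPolynomial.eval v F := by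
  classical
  rw [MvPolynomial.eval_eq, MvPolynomial.eval_eq, Finset.mul_sum]
  refine Finset.sum_congr rfl fun s hs => ?_
  have hd : Finsupp.weight (fun c : Coord M => Finsupp.single (grp c) 1) s = d :=
    hF (MvPolynomial.mem_support_iff.mp hs)
  have hprod : (d.prod fun i k => t i ^ k) = ∏ c ∈ s.support, t (grp c) ^ s c := by
    rw [← hd, Finsupp.weight_apply, Finsupp.prod_sum_index (by simp) (by simp [pow_add])]
    refine Finset.prod_congr rfl fun c _ => ?_
    simp [Finsupp.smul_single, Finsupp.prod_single_index]
  rw [hprod, mul_left_comm, ← Finset.prod_mul_distrib]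
  simp_rw [mul_pow]

lemma IsMultiHom.bind {F : MvPolynomial (Coord N) ℂ} {e : Idx N →₀ ℕ} (hF : IsMultiHom N F e)
    {G : Coord N → MvPolynomial (Coord M) ℂ} {d : Idx N → (Idx M →₀ ℕ)}
    (hG : ∀ c, IsMultiHom M (G c) (d (grp c))) :
    IsMultiHom M (MvPolynomial.bind₁ G F) (e.sum fun i k => k • d i) := by
  classical
  rw [F.as_sum, map_sum]
  refine MvPolynomial.IsWeightedHomogeneous.sum _ _ _ fun s hs => ?_
  have he : Finsupp.weight (fun c : Coord N => Finsupp.single (grp c) 1) s = e :=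
    hF (MvPolynomial.mem_support_iff.mp hs)
  have hsum : (e.sum fun i k => k • d i) = ∑ c ∈ s.support, s c • d (grp c) := by
    rw [← he, Finsupp.weight_apply, Finsupp.sum_sum_index (by simp) (by simp [add_smul])]
    refine Finset.sum_congr rfl fun c _ => ?_
    simp [Finsupp.smul_single, Finsupp.sum_single_index]
  rw [MvPolynomial.bind₁_monomial, hsum]
  exact (MvPolynomial.IsWeightedHomogeneous.prod _ _ _ fun c _ => (hG c).pow (s c)).C_mul _

/-- The function `f` is given by a multihomogeneous polynomial of multidegree `d` in the chosen
homogeneous coordinates. -/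
def IsForm (d : Idx M →₀ ℕ) (f : M → ℂ) : Prop :=
  ∃ F : MvPolynomial (Coord M) ℂ, IsMultiHom M F d ∧ ∀ x, evalAt F x = f x

lemma IsForm.coord (c : Coord M) : IsForm (Finsupp.single (grp c) 1) (fun x : M => rep x c) :=
  ⟨MvPolynomial.X c, MvPolynomial.isWeightedHomogeneous_X _ _ _, fun x => by simp [evalAt]⟩

lemma IsForm.const (r : ℂ) : IsForm 0 (fun _ : M => r) :=
  ⟨MvPolynomial.C r, MvPolynomial.isWeightedHomogeneous_C _ _, fun x => by simp [evalAt]⟩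

lemma IsForm.zero (d : Idx M →₀ ℕ) : IsForm d (fun _ : M => 0) :=
  ⟨0, MvPolynomial.isWeightedHomogeneous_zero _ _ _, fun x => by simp [evalAt]⟩

lemma IsForm.mul {d e : Idx M →₀ ℕ} {f g : M → ℂ} (hf : IsForm d f) (hg : IsForm e g) :
    IsForm (d + e) (fun x => f x * g x) := by
  obtain ⟨F, hF, hf⟩ := hf
  obtain ⟨G, hG, hg⟩ := hg
  exact ⟨F * G, MvPolynomial.IsWeightedHomogeneous.mul hF hG,
    fun x => by simp [← hf, ← hg, evalAt]⟩

lemma IsForm.const_mul {d : Idx M →₀ ℕ} {f : M → ℂ} (hf : IsForm d f) (r : ℂ) :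
    IsForm d (fun x => r * f x) := by
  simpa using (IsForm.const r).mul hf

lemma IsForm.sum {ι : Type*} {d : Idx M →₀ ℕ} {f : ι → M → ℂ} (s : Finset ι)
    (hf : ∀ i ∈ s, IsForm d (f i)) : IsForm d (fun x => ∑ i ∈ s, f i x) := by
  classical
  choose! F hF hf using hf
  refine ⟨∑ i ∈ s, F i, MvPolynomial.IsWeightedHomogeneous.sum _ _ _ hF, fun x => ?_⟩
  simp only [evalAt, map_sum]
  exact Finset.sum_congr rfl fun i hi => hf i hi x

lemma IsForm.sub {d : Idx M →₀ ℕ} {f g : M → ℂ} (hf : IsForm d f) (hg : IsForm d g) :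
    IsForm d (fun x => f x - g x) := by
  obtain ⟨F, hF, hf⟩ := hf
  obtain ⟨G, hG, hg⟩ := hg
  exact ⟨F - G, MvPolynomial.IsWeightedHomogeneous.sub hF hG,
    fun x => by simp [← hf, ← hg, evalAt]⟩

lemma IsForm.prod {ι : Type*} {d : ι → (Idx M →₀ ℕ)} {f : ι → M → ℂ} (s : Finset ι)
    (hf : ∀ i ∈ s, IsForm (d i) (f i)) : IsForm (∑ i ∈ s, d i) (fun x => ∏ i ∈ s, f i x) := by
  classical
  choose! F hF hf using hf
  refine ⟨∏ i ∈ s, F i, MvPolynomial.IsWeightedHomogeneous.prod _ _ _ hF, fun x => ?_⟩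
  simp only [evalAt, map_prod]
  exact Finset.prod_congr rfl fun i hi => hf i hi x

/-- A determinant whose columns are homogeneous is a form. -/
lemma IsForm.det {k : ℕ} {d : Fin k → (Idx M →₀ ℕ)} {A : M → Matrix (Fin k) (Fin k) ℂ}
    (hA : ∀ i j, IsForm (d j) (fun x => A x i j)) : IsForm (∑ j, d j) (fun x => (A x).det) := by
  simp_rw [Matrix.det_apply']
  exact IsForm.sum _ fun σ _ => (IsForm.prod _ fun i _ => hA (σ i) i).const_mul _

lemma IsForm.isOpen_ne {d : Idx M →₀ ℕ} {f : M → ℂ} (hf : IsForm d f) : IsOpen {x | f x ≠ 0} := by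
  obtain ⟨F, hF, hf⟩ := hf
  exact TopologicalSpace.isOpen_generateFrom_of_mem ⟨F, d, hF, by simp [hf]⟩

lemma IsForm.isClosed_eq {d : Idx M →₀ ℕ} {f g : M → ℂ} (hf : IsForm d f) (hg : IsForm d g) :
    IsClosed {x | f x = g x} := by
  rw [← isOpen_compl_iff]
  convert (hf.sub hg).isOpen_ne using 1
  ext x
  simp [sub_eq_zero]

/-- Equality of points is the vanishing of the 2×2 minors within each factor; this makes the locus
where two regular maps agree closed. -/
lemma eq_iff_rep_mul_rep {x y : M} :
    x = y ↔ ∀ c c' : Coord M, grp c = grp c' → rep x c * rep y c' = rep x c' * rep y c := by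
  constructor
  · rintro rfl c c' _
    ring
  · intro h
    choose b hb hbx using rep_ne_zero x
    -- The minor on `b i` and a coordinate where `y` does not vanish rules out a zero here.
    have hby : ∀ i, rep y (b i) ≠ 0 := fun i => by
      obtain ⟨c, hc, hy⟩ := rep_ne_zero y i
      intro h0
      have := h (b i) c (by rw [hb, hc])
      rw [h0, mul_zero] at this
      exact mul_ne_zero (hbx i) hy this
    -- Both points are represented by the vector `rep x`, the second one after rescaling each factor
    -- by a ratio of coordinates at `b`; uniqueness identifies them.
    obtain ⟨z, -, hz⟩ := existsUnique_point (M := M) (rep x) (rep_ne_zero x)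
    rw [hz x ⟨fun _ => 1, fun c => by simp⟩, hz y ⟨fun i => Units.mk0 _ (hbx i) / Units.mk0 _ (hby i),
      fun c => ?_⟩]
    have := h (b (grp c)) c (by rw [hb])
    have h0 := hby (grp c)
    simp only [Units.val_div_eq_div_val, Units.val_mk0]
    field_simp
    linear_combination -this

end Forms

/-! ### Regular maps -/

section RegularMaps

variable {M N K : Type} [MultiProj M] [MultiProj N] [MultiProj K]

/-- Any homogeneous coordinates may replace the chosen ones at the cost of a unit. Nonvanishing is
unaffected, and quotients of equal multidegree do not change. -/
lemma evalAt_of_eq_mul_rep {F : MvPolynomial (Coord N) ℂ} {e : Idx N →₀ ℕ} (hF : IsMultiHom N F e)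
    {v : Coord N → ℂ} {t : Idx N → ℂˣ} {y : N} (h : ∀ c, v c = t (grp c) * rep y c) :
    MvPolynomial.eval v F = (e.prod fun i k => (t i) ^ k : ℂˣ) * evalAt F y := by
  have hv : v = fun c => (fun i => (t i : ℂ)) (grp c) * rep y c := funext h
  rw [hv, hF.eval_mul (fun i => (t i : ℂ)), evalAt]
  congr 1
  simp [Finsupp.prod]

lemma evalAt_bind (F : MvPolynomial (Coord N) ℂ) (G : Coord N → MvPolynomial (Coord M) ℂ) (x : M) :
    evalAt (MvPolynomial.bind₁ G F) x = MvPolynomial.eval (fun c => evalAt (G c) x) F := by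
  exact MvPolynomial.eval₂Hom_bind₁ (RingHom.id ℂ) (rep x) G F

lemma IsRegularMapOn.mono {U V : Set M} {f : M → N} (hf : IsRegularMapOn V f) (h : U ⊆ V) :
    IsRegularMapOn U f := fun x hx => by
  obtain ⟨O, hO, hxO, F, d, hF, H⟩ := hf x (h hx)
  exact ⟨O, hO, hxO, F, d, hF, fun y hy => H y ⟨h hy.1, hy.2⟩⟩

lemma IsRegularMapOn.congr {U : Set M} {f g : M → N} (hf : IsRegularMapOn U f)
    (h : EqOn f g U) : IsRegularMapOn U g := fun x hx => by
  obtain ⟨O, hO, hxO, F, d, hF, H⟩ := hf x hx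
  exact ⟨O, hO, hxO, F, d, hF, fun y hy => by simpa [h hy.1] using H y hy⟩

/-- Locally, the preimage of the nonvanishing locus of `P` is the nonvanishing locus of `P` with the
coordinate polynomials substituted, since the two values differ by a unit. -/
lemma IsRegularMapOn.continuousOn {U : Set M} {f : M → N} (hf : IsRegularMapOn U f) :
    ContinuousOn f U := by
  refine continuousOn_to_generateFrom_iff.mpr ?_
  rintro x hx _ ⟨P, e, hP, rfl⟩ hfx
  obtain ⟨O, hO, hxO, F, d, hF, H⟩ := hf x hx
  have key : ∀ y ∈ U ∩ O, evalAt (MvPolynomial.bind₁ F P) y ≠ 0 ↔ evalAt P (f y) ≠ 0 := by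
    intro y hy
    obtain ⟨t, ht⟩ := H y hy
    rw [evalAt_bind, evalAt_of_eq_mul_rep hP ht]
    simp
  rw [mem_nhdsWithin]
  refine ⟨O ∩ {y | evalAt (MvPolynomial.bind₁ F P) y ≠ 0}, hO.inter
    (IsForm.isOpen_ne ⟨_, hP.bind hF, fun _ => rfl⟩), ⟨hxO, (key x ⟨hx, hxO⟩).mpr hfx⟩, ?_⟩
  rintro y ⟨⟨hyO, hy⟩, hyU⟩
  exact (key y ⟨hyU, hyO⟩).mp hy

lemma IsRegularMapOn.comp {U : Set M} {V : Set N} {f : M → N} {g : N → K}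
    (hg : IsRegularMapOn V g) (hf : IsRegularMapOn U f) (h : MapsTo f U V) :
    IsRegularMapOn U (fun x => g (f x)) := fun x hx => by
  obtain ⟨O, hO, hxO, F, d, hF, H⟩ := hf x hx
  obtain ⟨O', hO', hxO', G, e, hG, H'⟩ := hg (f x) (h hx)
  obtain ⟨W, hW, hWU⟩ := continuousOn_iff'.mp hf.continuousOn O' hO'
  -- `W` is an open set that cuts the preimage of `O'` out of `U`.
  have hWm : ∀ y ∈ U, y ∈ W → f y ∈ O' := fun y hy hyW =>
    (hWU.symm.subset ⟨hyW, hy⟩ : y ∈ f ⁻¹' O' ∩ U).1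
  refine ⟨O ∩ W, hO.inter hW, ⟨hxO, (hWU.subset ⟨hxO', hx⟩).1⟩,
    fun c => MvPolynomial.bind₁ F (G c), fun i => (e i).sum fun i k => k • d i,
    fun c => (hG c).bind hF, fun y hy => ?_⟩
  obtain ⟨t, ht⟩ := H y ⟨hy.1, hy.2.1⟩
  obtain ⟨s, hs⟩ := H' (f y) ⟨h hy.1, hWm y hy.1 hy.2.2⟩
  refine ⟨fun i => ((e i).prod fun i k => (t i) ^ k) * s i, fun c => ?_⟩
  rw [evalAt_bind, evalAt_of_eq_mul_rep (hG c) ht, hs, Units.val_mul, mul_assoc]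

lemma IsRegularFunOn.comp {U : Set M} {V : Set N} {f : M → N} {g : N → ℂ}
    (hg : IsRegularFunOn V g) (hf : IsRegularMapOn U f) (h : MapsTo f U V) :
    IsRegularFunOn U (fun x => g (f x)) := fun x hx => by
  obtain ⟨O, hO, hxO, F, d, hF, H⟩ := hf x hx
  obtain ⟨O', hO', hxO', P, Q, e, hP, hQ, H'⟩ := hg (f x) (h hx)
  obtain ⟨W, hW, hWU⟩ := continuousOn_iff'.mp hf.continuousOn O' hO'
  have hWm : ∀ y ∈ U, y ∈ W → f y ∈ O' := fun y hy hyW =>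
    (hWU.symm.subset ⟨hyW, hy⟩ : y ∈ f ⁻¹' O' ∩ U).1
  refine ⟨O ∩ W, hO.inter hW, ⟨hxO, (hWU.subset ⟨hxO', hx⟩).1⟩,
    MvPolynomial.bind₁ F P, MvPolynomial.bind₁ F Q, _, hP.bind hF, hQ.bind hF, fun y hy => ?_⟩
  obtain ⟨t, ht⟩ := H y ⟨hy.1, hy.2.1⟩
  obtain ⟨h1, h2⟩ := H' (f y) ⟨h hy.1, hWm y hy.1 hy.2.2⟩
  rw [evalAt_bind, evalAt_bind, evalAt_of_eq_mul_rep hP ht, evalAt_of_eq_mul_rep hQ ht]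
  exact ⟨mul_ne_zero (Units.ne_zero _) h1,
    h2.trans (mul_div_mul_left _ _ (Units.ne_zero _)).symm⟩

lemma IsRegularMapOn.of_isForm {U : Set M} {f : M → N} {g : Coord N → M → ℂ}
    {d : Idx N → (Idx M →₀ ℕ)} (hg : ∀ c, IsForm (d (grp c)) (g c))
    (h : ∀ y ∈ U, ∃ t : Idx N → ℂˣ, ∀ c, g c y = t (grp c) * rep (f y) c) :
    IsRegularMapOn U f := fun x _ => by
  choose F hF hg using hg
  exact ⟨univ, isOpen_univ, trivial, F, d, hF, fun y hy => by simpa [hg] using h y hy.1⟩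

lemma IsRegularMapOn.id (U : Set M) : IsRegularMapOn U (fun x : M => x) :=
  .of_isForm (d := fun i => Finsupp.single i 1) IsForm.coord fun _ _ => ⟨1, by simp⟩

lemma IsRegularMapOn.const (U : Set M) (y : N) : IsRegularMapOn U (fun _ : M => y) :=
  .of_isForm (d := fun _ => 0) (fun c => IsForm.const (rep y c)) fun _ _ => ⟨1, by simp⟩

lemma IsRegularMapOn.fst' (U : Set (M × N)) : IsRegularMapOn U (fun x => x.1) :=
  .of_isForm (d := fun i => Finsupp.single (Sum.inl i : Idx M ⊕ Idx N) 1)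
    (fun c => IsForm.coord (M := M × N) (Sum.inl c)) fun _ _ => ⟨1, fun c => by simp; rfl⟩

lemma IsRegularMapOn.snd' (U : Set (M × N)) : IsRegularMapOn U (fun x => x.2) :=
  .of_isForm (d := fun i => Finsupp.single (Sum.inr i : Idx M ⊕ Idx N) 1)
    (fun c => IsForm.coord (M := M × N) (Sum.inr c)) fun _ _ => ⟨1, fun c => by simp; rfl⟩

lemma IsRegularMapOn.eval' {k : ℕ} (U : Set (Fin k → M)) (j : Fin k) :
    IsRegularMapOn U (fun x => x j) :=
  .of_isForm (d := fun i => Finsupp.single ((j, i) : Fin k × Idx M) 1)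
    (fun c => IsForm.coord (M := Fin k → M) (j, c)) fun _ _ => ⟨1, fun c => by simp; rfl⟩

lemma IsRegularMapOn.fst {U : Set K} {f : K → M × N} (hf : IsRegularMapOn U f) :
    IsRegularMapOn U (fun x => (f x).1) := (fst' univ).comp hf (mapsTo_univ _ _)

lemma IsRegularMapOn.snd {U : Set K} {f : K → M × N} (hf : IsRegularMapOn U f) :
    IsRegularMapOn U (fun x => (f x).2) := (snd' univ).comp hf (mapsTo_univ _ _)

lemma IsRegularMapOn.eval {k : ℕ} {U : Set K} {f : K → Fin k → M} (hf : IsRegularMapOn U f)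
    (j : Fin k) : IsRegularMapOn U (fun x => f x j) := (eval' univ j).comp hf (mapsTo_univ _ _)

lemma IsRegularMapOn.prodMk {U : Set K} {f : K → M} {g : K → N} (hf : IsRegularMapOn U f)
    (hg : IsRegularMapOn U g) : IsRegularMapOn U (fun x => (f x, g x)) := fun x hx => by
  obtain ⟨O, hO, hxO, F, d, hF, H⟩ := hf x hx
  obtain ⟨O', hO', hxO', F', d', hF', H'⟩ := hg x hx
  refine ⟨O ∩ O', hO.inter hO', ⟨hxO, hxO'⟩, Sum.elim F F', Sum.elim d d', ?_, fun y hy => ?_⟩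
  · rintro (c | c)
    · exact hF c
    · exact hF' c
  · obtain ⟨t, ht⟩ := H y ⟨hy.1, hy.2.1⟩
    obtain ⟨t', ht'⟩ := H' y ⟨hy.1, hy.2.2⟩
    refine ⟨Sum.elim t t', ?_⟩
    rintro (c | c)
    · exact ht c
    · exact ht' c

lemma IsRegularMapOn.pi {k : ℕ} {U : Set K} {f : K → Fin k → M}
    (hf : ∀ j, IsRegularMapOn U (fun x => f x j)) : IsRegularMapOn U f := fun x hx => by
  choose O hO hxO F d hF H using fun j => hf j x hx
  refine ⟨⋂ j, O j, isOpen_iInter_of_finite hO, mem_iInter.mpr hxO, fun c => F c.1 c.2,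
    fun i => d i.1 i.2, fun c => hF c.1 c.2, fun y hy => ?_⟩
  choose t ht using fun j => H j y ⟨hy.1, mem_iInter.mp hy.2 j⟩
  exact ⟨fun i => t i.1 i.2, fun c => ht c.1 c.2⟩

/-- The set where two regular maps differ is open. -/
lemma exists_isOpen_ne {U : Set M} {f g : M → N} (hf : IsRegularMapOn U f)
    (hg : IsRegularMapOn U g) {x : M} (hx : x ∈ U) (hne : f x ≠ g x) :
    ∃ O, IsOpen O ∧ x ∈ O ∧ ∀ y ∈ U ∩ O, f y ≠ g y := by
  obtain ⟨O, hO, hxO, F, d, hF, H⟩ := hf x hx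
  obtain ⟨O', hO', hxO', G, e, hG, H'⟩ := hg x hx
  rw [ne_eq, eq_iff_rep_mul_rep] at hne
  push Not at hne
  obtain ⟨c, c', hcc, hne⟩ := hne
  -- The minor in local coordinates is a unit times the minor in chosen coordinates: as `c` and `c'`
  -- lie in one factor, both products carry the same scalars and the same multidegree.
  have key : ∀ y ∈ U, y ∈ O → y ∈ O' →
      (evalAt (F c) y * evalAt (G c') y - evalAt (F c') y * evalAt (G c) y ≠ 0 ↔
        rep (f y) c * rep (g y) c' ≠ rep (f y) c' * rep (g y) c) := by
    intro y hyU hyO hyO'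
    obtain ⟨t, ht⟩ := H y ⟨hyU, hyO⟩
    obtain ⟨s, hs⟩ := H' y ⟨hyU, hyO'⟩
    rw [ht, ht, hs, hs, hcc]
    rw [show ∀ a b c d s t : ℂ, t * a * (s * b) - t * c * (s * d) = t * s * (a * b - c * d) by
      intros; ring]
    simp [sub_eq_zero]
  refine ⟨O ∩ O' ∩ {y | evalAt (F c) y * evalAt (G c') y - evalAt (F c') y * evalAt (G c) y ≠ 0},
    (hO.inter hO').inter (IsForm.isOpen_ne (d := d (grp c') + e (grp c')) ?_),
    ⟨⟨hxO, hxO'⟩, (key x hx hxO hxO').mpr hne⟩, ?_⟩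
  · exact IsForm.sub (.mul ⟨_, hcc ▸ hF c, fun _ => rfl⟩ ⟨_, hG c', fun _ => rfl⟩)
      (.mul ⟨_, hF c', fun _ => rfl⟩ ⟨_, hcc ▸ hG c, fun _ => rfl⟩)
  · rintro y ⟨hyU, ⟨hyO, hyO'⟩, hy⟩ heq
    exact (key y hyU hyO hyO').mp hy (eq_iff_rep_mul_rep.mp heq c c' hcc)

/-- The set where two regular functions differ is open. -/
lemma exists_isOpen_fun_ne {U : Set M} {f g : M → ℂ} (hf : IsRegularFunOn U f)
    (hg : IsRegularFunOn U g) {x : M} (hx : x ∈ U) (hne : f x ≠ g x) :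
    ∃ O, IsOpen O ∧ x ∈ O ∧ ∀ y ∈ U ∩ O, f y ≠ g y := by
  obtain ⟨O, hO, hxO, F, G, d, hF, hG, H⟩ := (hf.add ((IsRegularFunOn.const U (-1)).mul hg)) x hx
  have key : ∀ y ∈ U ∩ O, (evalAt F y ≠ 0 ↔ f y ≠ g y) := by
    intro y hy
    obtain ⟨h1, h2⟩ := H y hy
    rw [eq_div_iff h1] at h2
    rw [← h2]
    simp [h1, ← sub_eq_add_neg, sub_eq_zero]
  exact ⟨O ∩ {y | evalAt F y ≠ 0}, hO.inter (IsForm.isOpen_ne ⟨F, hF, fun _ => rfl⟩),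
    ⟨hxO, (key x ⟨hx, hxO⟩).mpr hne⟩, fun y hy => (key y ⟨hy.1, hy.2.1⟩).mp hy.2.2⟩

end RegularMaps

/-! ### Irreducibility and generic points -/

section Generic

variable {M N K : Type} [MultiProj M] [MultiProj N] [MultiProj K]

/-- Products of multihomogeneous polynomials are multihomogeneous, so the nonvanishing loci, given
only as a subbasis, form a basis. -/
lemma exists_isMultiHom_of_isOpen {O : Set M} (hO : IsOpen O) {x : M} (hx : x ∈ O) :
    ∃ (F : MvPolynomial (Coord M) ℂ) (d : Idx M →₀ ℕ), IsMultiHom M F d ∧ evalAt F x ≠ 0 ∧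
      ∀ y, evalAt F y ≠ 0 → y ∈ O := by
  induction hO with
  | basic s hs =>
    obtain ⟨F, d, hF, rfl⟩ := hs
    exact ⟨F, d, hF, hx, fun y hy => hy⟩
  | univ => exact ⟨1, 0, MvPolynomial.isWeightedHomogeneous_one _ _, by simp [evalAt], by simp⟩
  | inter s t _ _ hs ht =>
    obtain ⟨F, d, hF, h1, h2⟩ := hs hx.1
    obtain ⟨G, e, hG, h3, h4⟩ := ht hx.2
    refine ⟨F * G, d + e, MvPolynomial.IsWeightedHomogeneous.mul hF hG, ?_, fun y hy => ?_⟩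
    · simpa [evalAt] using ⟨h1, h3⟩
    · simp only [evalAt, map_mul, ne_eq, mul_eq_zero, not_or] at hy
      exact ⟨h2 y hy.1, h4 y hy.2⟩
  | sUnion S _ ih =>
    obtain ⟨s, hs, hxs⟩ := hx
    obtain ⟨F, d, hF, h1, h2⟩ := ih s hs hxs
    exact ⟨F, d, hF, h1, fun y hy => ⟨s, hs, h2 y hy⟩⟩

lemma isIrreducible_univ [Nonempty M] : IsIrreducible (univ : Set M) := by
  refine ⟨univ_nonempty, ?_⟩
  rintro U V hU hV ⟨x, -, hx⟩ ⟨y, -, hy⟩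
  obtain ⟨F, d, hF, hFx, hFU⟩ := exists_isMultiHom_of_isOpen hU hx
  obtain ⟨G, e, hG, hGy, hGV⟩ := exists_isMultiHom_of_isOpen hV hy
  have := finite_coord (M := M)
  have := Fintype.ofFinite (Coord M)
  -- The product of all variables forces the vector found below to have no zero coordinate, so that
  -- it represents a point.
  have hne : F * G * ∏ c, MvPolynomial.X c ≠ 0 := by
    refine mul_ne_zero (mul_ne_zero ?_ ?_)
      (Finset.prod_ne_zero_iff.mpr fun c _ => MvPolynomial.X_ne_zero c)
    · rintro rfl
      simp [evalAt] at hFx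
    · rintro rfl
      simp [evalAt] at hGy
  obtain ⟨v, hv⟩ : ∃ v, MvPolynomial.eval v (F * G * ∏ c, MvPolynomial.X c) ≠ 0 := by
    by_contra! h
    exact hne (MvPolynomial.funext fun v => by simpa using h v)
  simp only [map_mul, map_prod, MvPolynomial.eval_X, ne_eq, mul_eq_zero, not_or,
    Finset.prod_eq_zero_iff, Finset.mem_univ, true_and, not_exists] at hv
  obtain ⟨z, ⟨t, ht⟩, -⟩ := existsUnique_point v fun i => by
    obtain ⟨c, hc, -⟩ := rep_ne_zero x i
    exact ⟨c, hc, hv.2 c⟩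
  rw [evalAt_of_eq_mul_rep hF ht, evalAt_of_eq_mul_rep hG ht] at hv
  exact ⟨z, trivial, hFU z (right_ne_zero_of_mul hv.1.1), hGV z (right_ne_zero_of_mul hv.1.2)⟩

lemma isIrreducible_of_isOpen {U : Set M} (hU : IsOpen U) (hne : U.Nonempty) :
    IsIrreducible U := by
  have : Nonempty M := ⟨hne.some⟩
  exact ⟨hne, isIrreducible_univ.2.open_subset hU (subset_univ _)⟩

/-- The Zariski topology of `M × N` is not the product topology, but the slice inclusions are
continuous and that is enough: a common `b` is found over the two base points `x` and `x'`, and then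
`a` is found in the slice over `b`. -/
lemma isIrreducible_prod {X : Set M} {Y : Set N} (hX : IsIrreducible X) (hY : IsIrreducible Y) :
    IsIrreducible (X ×ˢ Y) := by
  refine ⟨hX.1.prod hY.1, ?_⟩
  rintro U V hU hV ⟨⟨x, y⟩, ⟨hx, hy⟩, hxy⟩ ⟨⟨x', y'⟩, ⟨hx', hy'⟩, hxy'⟩
  have c1 : ∀ a : M, Continuous fun b : N => (a, b) := fun a => continuousOn_univ.mp
    ((IsRegularMapOn.const univ a).prodMk (IsRegularMapOn.id univ)).continuousOn
  have c2 : ∀ b : N, Continuous fun a : M => (a, b) := fun b => continuousOn_univ.mp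
    ((IsRegularMapOn.id univ).prodMk (IsRegularMapOn.const univ b)).continuousOn
  obtain ⟨b, hb, hb1, hb2⟩ := hY.2 _ _ (hU.preimage (c1 x)) (hV.preimage (c1 x'))
    ⟨y, hy, hxy⟩ ⟨y', hy', hxy'⟩
  obtain ⟨a, ha, ha1, ha2⟩ := hX.2 _ _ (hU.preimage (c2 b)) (hV.preimage (c2 b))
    ⟨x, hx, hb1⟩ ⟨x', hx', hb2⟩
  exact ⟨(a, b), ⟨ha, hb⟩, ha1, ha2⟩

lemma isIrreducible_image {X : Set M} {f : M → N} (hX : IsIrreducible X)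
    (hf : IsRegularMapOn X f) : IsIrreducible (f '' X) :=
  ⟨hX.1.image f, hX.2.image f hf.continuousOn⟩

/-- In an irreducible set, density of a relatively open subset amounts to having one point. This is
how all density claims below are checked. -/
lemma isDenseOpenIn_iff {X U : Set M} (hX : IsIrreducible X) :
    IsDenseOpenIn X U ↔ (∃ O, IsOpen O ∧ U = X ∩ O) ∧ U.Nonempty := by
  refine and_congr_right ?_
  rintro ⟨O, hO, rfl⟩
  constructor
  · intro h
    exact closure_nonempty_iff.mp (hX.1.mono h)
  · intro h
    exact subset_closure_inter_of_isPreirreducible_of_isOpen hX.2 hO h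

lemma IsDenseOpenIn.subset {X U : Set M} (hU : IsDenseOpenIn X U) : U ⊆ X := by
  obtain ⟨⟨O, -, rfl⟩, -⟩ := hU
  exact inter_subset_left

lemma IsDenseOpenIn.nonempty {X U : Set M} (hX : IsIrreducible X) (hU : IsDenseOpenIn X U) :
    U.Nonempty := ((isDenseOpenIn_iff hX).mp hU).2

lemma IsDenseOpenIn.mem_gen {X U : Set M} (hU : IsDenseOpenIn X U) : U ∈ gen X :=
  ⟨U, hU, subset_rfl⟩

lemma gen_neBot {X : Set M} (hX : IsIrreducible X) : (gen X).NeBot := by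
  refine neBot_iff.mpr fun h => ?_
  obtain ⟨U, hU, h0⟩ : ∅ ∈ gen X := by simp [h]
  exact (hU.nonempty hX).not_subset_empty h0

lemma isDenseOpenIn_prod {X U : Set M} {Y V : Set N} (hX : IsIrreducible X) (hY : IsIrreducible Y)
    (hU : IsDenseOpenIn X U) (hV : IsDenseOpenIn Y V) : IsDenseOpenIn (X ×ˢ Y) (U ×ˢ V) := by
  rw [isDenseOpenIn_iff (isIrreducible_prod hX hY)]
  refine ⟨?_, (hU.nonempty hX).prod (hV.nonempty hY)⟩
  obtain ⟨⟨O, hO, rfl⟩, -⟩ := hU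
  obtain ⟨⟨O', hO', rfl⟩, -⟩ := hV
  refine ⟨{z | z.1 ∈ O} ∩ {z | z.2 ∈ O'}, ?_, by ext; simp; tauto⟩
  exact (hO.preimage (continuousOn_univ.mp (IsRegularMapOn.fst' univ).continuousOn)).inter
    (hO'.preimage (continuousOn_univ.mp (IsRegularMapOn.snd' univ).continuousOn))

lemma IsDenseOpenIn.preimage {X U : Set M} {Y W : Set N} {f : M → N} (hX : IsIrreducible X)
    (hU : IsDenseOpenIn X U) (hf : IsRegularMapOn U f) (hfm : MapsTo f U Y)
    (hW : IsDenseOpenIn Y W) (hne : (U ∩ f ⁻¹' W).Nonempty) : IsDenseOpenIn X (U ∩ f ⁻¹' W) := by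
  refine (isDenseOpenIn_iff hX).mpr ⟨?_, hne⟩
  obtain ⟨⟨O, hO, rfl⟩, -⟩ := hU
  obtain ⟨⟨O', hO', rfl⟩, -⟩ := hW
  obtain ⟨V, hV, hVO⟩ := continuousOn_iff'.mp hf.continuousOn O' hO'
  refine ⟨O ∩ V, hO.inter hV, ?_⟩
  ext x
  have := Set.ext_iff.mp hVO x
  have := @hfm x
  simp only [mem_inter_iff, mem_preimage] at *
  tauto

/-- Dominance only requires that the image of `U` meet every dense open subset of the target. -/
lemma tendsto_gen {X U : Set M} {Y : Set N} {f : M → N} (hX : IsIrreducible X)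
    (hU : IsDenseOpenIn X U) (hf : IsRegularMapOn U f) (hfm : MapsTo f U Y)
    (h : ∀ W, IsDenseOpenIn Y W → (U ∩ f ⁻¹' W).Nonempty) : Tendsto f (gen X) (gen Y) := by
  rintro S ⟨W, hW, hWS⟩
  exact ⟨_, hU.preimage hX hf hfm hW (h W hW), fun x hx => hWS hx.2⟩

/-! ### Birational maps -/

/-- Mutually inverse regular maps between dense open subsets define a birational map. -/
lemma isBirational_of_inverse {X U : Set M} {Y V : Set N} {f : M → N} {g : N → M}
    (hX : IsIrreducible X) (hY : IsIrreducible Y) (hU : IsDenseOpenIn X U)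
    (hV : IsDenseOpenIn Y V) (hf : IsRegularMapOn U f) (hfm : MapsTo f U V)
    (hg : IsRegularMapOn V g) (hgm : MapsTo g V U) (hgf : ∀ x ∈ U, g (f x) = x)
    (hfg : ∀ y ∈ V, f (g y) = y) : IsBirational X Y f := by
  refine ⟨⟨⟨U, hU, hfm.mono_right hV.subset, hf⟩, ?_⟩, g, ⟨⟨V, hV, hgm.mono_right hU.subset, hg⟩, ?_⟩,
    mem_of_superset hU.mem_gen hgf, mem_of_superset hV.mem_gen hfg⟩
  · refine tendsto_gen hX hU hf (hfm.mono_right hV.subset) fun W hW => ?_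
    obtain ⟨y, hyV, hyW⟩ := (hV.inter hW).nonempty hY
    exact ⟨g y, hgm hyV, by simpa [hfg y hyV] using hyW⟩
  · refine tendsto_gen hY hV hg (hgm.mono_right hU.subset) fun W hW => ?_
    obtain ⟨x, hxU, hxW⟩ := (hU.inter hW).nonempty hX
    exact ⟨f x, hfm hxU, by simpa [hgf x hxU] using hxW⟩

lemma IsBiregular.isBirational {X : Set M} {Y : Set N} {f : M → N} (hX : IsIrreducible X)
    (hY : IsIrreducible Y) (hf : IsBiregular X Y f) : IsBirational X Y f := by
  obtain ⟨⟨hfm, hf⟩, g, ⟨hgm, hg⟩, hgf, hfg⟩ := hf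
  exact isBirational_of_inverse hX hY (isDenseOpenIn_self X) (isDenseOpenIn_self Y) hf hfm hg hgm
    hgf hfg

lemma IsDominantRationalMap.comp {X : Set M} {Y : Set N} {Z : Set K} {f : M → N} {g : N → K}
    (hX : IsIrreducible X) (hg : IsDominantRationalMap Y Z g)
    (hf : IsDominantRationalMap X Y f) : IsDominantRationalMap X Z (fun x => g (f x)) := by
  obtain ⟨⟨U, hU, hfm, hfr⟩, hf⟩ := hf
  obtain ⟨⟨V, hV, hgm, hgr⟩, hg⟩ := hg
  have := gen_neBot hX
  refine ⟨⟨U ∩ f ⁻¹' V, hU.preimage hX hfr hfm hV ?_, fun x hx => hgm hx.2,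
    hgr.comp (hfr.mono inter_subset_left) fun x hx => hx.2⟩, hg.comp hf⟩
  exact nonempty_of_mem (inter_mem hU.mem_gen (hf hV.mem_gen))

lemma IsBirational.comp {X : Set M} {Y : Set N} {Z : Set K} {f : M → N} {g : N → K}
    (hX : IsIrreducible X) (hZ : IsIrreducible Z) (hg : IsBirational Y Z g)
    (hf : IsBirational X Y f) : IsBirational X Z (fun x => g (f x)) := by
  obtain ⟨hf, f', hf', h1, h2⟩ := hf
  obtain ⟨hg, g', hg', h3, h4⟩ := hg
  refine ⟨hg.comp hX hf, fun z => f' (g' z), hf'.comp hZ hg', ?_, ?_⟩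
  · filter_upwards [h1, hf.2.eventually h3] with x hx hx'
    rw [hx', hx]
  · filter_upwards [h4, hg'.2.eventually h2] with x hx hx'
    rw [hx', hx]

/-- If the composite moved a point where both maps are defined, it would move all nearby points of
`X`, since the locus where two regular maps differ is open. That locus would be dense and would meet
the dense set on which the composite is the identity. -/
lemma compEqIdWhereDefined_of_eventually {X : Set M} {Y : Set N} {f : M → N} {g : N → M}
    (hX : IsIrreducible X) (hf : Tendsto f (gen X) (gen Y)) (h : ∀ᶠ x in gen X, g (f x) = x) :
    CompEqIdWhereDefined X Y f g := by
  rintro f' g' hf' hg' x hx ⟨O, hO, hxO, hfm, hfr⟩ ⟨O', hO', hxO', hgm, hgr⟩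
  by_contra hne
  obtain ⟨W, hW, hWO⟩ := continuousOn_iff'.mp hfr.continuousOn O' hO'
  have hWm : ∀ y ∈ X, y ∈ O → y ∈ W → f' y ∈ O' := fun y hy hyO hyW =>
    (hWO.symm.subset ⟨hyW, hy, hyO⟩ : y ∈ f' ⁻¹' O' ∩ (X ∩ O)).1
  have hxW : x ∈ W := (hWO.subset ⟨hxO', hx, hxO⟩).1
  have hr : IsRegularMapOn (X ∩ (O ∩ W)) (fun x => g' (f' x)) :=
    hgr.comp (hfr.mono fun y hy => ⟨hy.1, hy.2.1⟩)
      fun y hy => ⟨hfm ⟨hy.1, hy.2.1⟩, hWm y hy.1 hy.2.1 hy.2.2⟩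
  obtain ⟨V, hV, hxV, hVne⟩ := exists_isOpen_ne hr (IsRegularMapOn.id _) ⟨hx, hxO, hxW⟩ hne
  have hD : IsDenseOpenIn X (X ∩ (O ∩ W ∩ V)) :=
    (isDenseOpenIn_iff hX).mpr ⟨⟨_, (hO.inter hW).inter hV, rfl⟩, x, hx, ⟨hxO, hxW⟩, hxV⟩
  have := gen_neBot hX
  obtain ⟨y, ⟨hyX, hyOW, hyV⟩, hy1, hy2, hy3⟩ := Filter.nonempty_of_mem
    (inter_mem hD.mem_gen (inter_mem hf' (inter_mem (hf.eventually hg') h)))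
  refine hVne y ⟨⟨hyX, hyOW⟩, hyV⟩ ?_
  exact (congrArg g' hy1).trans (hy2.trans hy3)

end Generic

/-! ### Rational quotients from local sections -/

section Quotient

variable {H M N : Type} [MultiProj H] [MultiProj M] [MultiProj N]

/-- Composition of germs with a map, as a homomorphism of algebras. -/
def germComp {α β : Type} {l : Filter α} {l' : Filter β} (φ : α → β) (h : Tendsto φ l l') :
    Germ l' ℂ →ₐ[ℂ] Germ l ℂ where
  toFun g := g.compTendsto φ h
  map_one' := rfl
  map_zero' := rfl
  map_mul' x y := by
    induction x using Germ.inductionOn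
    induction y using Germ.inductionOn
    rfl
  map_add' x y := by
    induction x using Germ.inductionOn
    induction y using Germ.inductionOn
    rfl
  commutes' r := by
    rw [germ_algebraMap, germ_algebraMap]
    rfl

/-- A morphism whose fibres are orbits and which has a section through every point, both on dense
open subsets, is a rational quotient. -/
theorem isRationalQuotient_of_sections {G : Set H} {mul : H → H → H} {inv : H → H} {one : H}
    {X X₀ : Set M} {act : H → M → M} {Y Y₀ : Set N} {φ : M → N}
    (hG : IsAlgebraicGroup G mul inv one) (hX : IsVariety X) (hY : IsVariety Y)
    (hact : IsRationalAction G mul one X act) (hactm : ∀ g ∈ G, IsMorphism X X (act g))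
    (hX₀ : IsDenseOpenIn X X₀) (hY₀ : IsDenseOpenIn Y Y₀) (hφ : IsRegularMapOn X₀ φ)
    (hφm : MapsTo φ X₀ Y₀)
    (hinv : ∀ g ∈ G, ∀ x ∈ X₀, φ (act g x) = φ x)
    (horb : ∀ x ∈ X₀, ∀ x' ∈ X₀, φ x = φ x' → ∃ g ∈ G, act g x = x')
    (hsec : ∀ x ∈ X₀, ∃ s : N → M, IsRegularMapOn Y₀ s ∧ MapsTo s Y₀ X₀ ∧ (∀ y ∈ Y₀, φ (s y) = y) ∧
      s (φ x) = x) :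
    IsRationalQuotient G mul inv one X act Y φ := by
  have hφm' : MapsTo φ X₀ Y := hφm.mono_right hY₀.subset
  have htend : Tendsto φ (gen X) (gen Y) := by
    refine tendsto_gen hX.2 hX₀ hφ hφm' fun W hW => ?_
    obtain ⟨x, hx⟩ := hX₀.nonempty hX.2
    obtain ⟨s, -, hsm, hs, -⟩ := hsec x hx
    obtain ⟨y, hyY, hyW⟩ := (hY₀.inter hW).nonempty hY.2
    exact ⟨s y, hsm hyY, by simpa [hs y hyY] using hyW⟩
  refine ⟨hG, hX, hY, hact, ⟨X₀, hX₀, hφm', hφ⟩, htend, ?_⟩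
  have hmem : ∀ h : RatFun Y, (germComp φ htend).comp (RatFun Y).val h ∈ Invariants G X act := by
    rintro ⟨_, f, V, rfl, hV, hf⟩
    have := gen_neBot hX.2
    refine ⟨⟨fun x => f (φ x), X₀ ∩ φ ⁻¹' V, rfl, hX₀.preimage hX.2 hφ hφm' hV ?_,
      hf.comp (hφ.mono inter_subset_left) fun x hx => hx.2⟩, fun x => f (φ x), rfl, fun g hg => ?_⟩
    · exact nonempty_of_mem (inter_mem hX₀.mem_gen (htend hV.mem_gen))
    · filter_upwards [hX₀.mem_gen] with x hx
      rw [hinv g hg x hx]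
  refine ⟨AlgEquiv.ofBijective (((germComp φ htend).comp (RatFun Y).val).codRestrict _ hmem)
    ⟨?_, ?_⟩, fun h => rfl⟩
  · rintro ⟨_, f, V, rfl, hV, hf⟩ ⟨_, f', V', rfl, hV', hf'⟩ heq
    have heq : ((fun x => f (φ x) : M → ℂ) : Germ (gen X) ℂ) = (fun x => f' (φ x) : M → ℂ) :=
      congrArg Subtype.val heq
    -- Injectivity: an equality of the pullbacks is moved back to `Y` along a section through a
    -- point of `U`, where φ ∘ s = id.
    obtain ⟨U, hU, hUf⟩ := Germ.coe_eq.mp heq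
    obtain ⟨x, hxX, hxU⟩ := (hX₀.inter hU).nonempty hX.2
    obtain ⟨s, hsr, hsm, hs, hsx⟩ := hsec x hxX
    have hd := hY₀.preimage hY.2 hsr (hsm.mono_right hX₀.subset) hU
      ⟨φ x, hφm hxX, by simpa [hsx] using hxU⟩
    refine Subtype.ext (Germ.coe_eq.mpr ?_)
    filter_upwards [hd.mem_gen] with y hy
    have := hUf hy.2
    simpa [hs y hy.1] using this
  · rintro ⟨h, ⟨f, U, rfl, hU, hf⟩, f', hff', hf'⟩
    have hff' := Germ.coe_eq.mp hff'
    -- The invariant representative `f'` need not be the regular one. Invariance passes to `f`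
    -- because `act g` is dominant.
    have hfinv : ∀ g ∈ G, ∀ᶠ x in gen X, f (act g x) = f x := fun g hg => by
      filter_upwards [hf' g hg, hff', (hact.birational g hg).1.2.eventually hff'] with x h1 h2 h3
      rw [h2, h3, h1]
    -- For each `g`, generic invariance becomes invariance at every point where both sides are
    -- regular, because inequality would be an open condition. The pointwise form is needed below,
    -- where `g` varies with the point `z` and a dense open set depending on `g` would be useless.
    have hconst : ∀ g ∈ G, ∀ x ∈ U, act g x ∈ U → f (act g x) = f x := by
      intro g hg x hx hgx
      by_contra hne
      have hreg := (hactm g hg).2.mono hU.subset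
      have hd : IsDenseOpenIn X (U ∩ act g ⁻¹' U) :=
        hU.preimage hX.2 hreg ((hactm g hg).1.mono_left hU.subset) hU ⟨x, hx, hgx⟩
      obtain ⟨W, hW, hxW, hWne⟩ := exists_isOpen_fun_ne (U := U ∩ act g ⁻¹' U)
        (hf.comp (hreg.mono inter_subset_left) fun y hy => hy.2) (hf.mono inter_subset_left)
        ⟨hx, hgx⟩ hne
      obtain ⟨⟨O', hO', hUO'⟩, -⟩ := id hd
      have hd' : IsDenseOpenIn X (X ∩ (O' ∩ W)) := by
        refine (isDenseOpenIn_iff hX.2).mpr ⟨⟨_, hO'.inter hW, rfl⟩, x, hU.subset hx, ?_, hxW⟩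
        exact (hUO'.subset ⟨hx, hgx⟩).2
      have := gen_neBot hX.2
      obtain ⟨y, ⟨hyX, hyO, hyW⟩, hy⟩ := Filter.nonempty_of_mem (inter_mem hd'.mem_gen (hfinv g hg))
      exact hWne y ⟨hUO'.symm.subset ⟨hyX, hyO⟩, hyW⟩ hy
    obtain ⟨x, hxX, hxU⟩ := (hX₀.inter hU).nonempty hX.2
    obtain ⟨s, hsr, hsm, hs, hsx⟩ := hsec x hxX
    have hd := hY₀.preimage hY.2 hsr (hsm.mono_right hX₀.subset) hU
      ⟨φ x, hφm hxX, by simpa [hsx] using hxU⟩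
    -- The invariant function descends to f ∘ s: the points `z` and s(φ z) lie in one orbit, so `f`
    -- agrees on them.
    refine ⟨⟨_, fun y => f (s y), _, rfl, hd,
      hf.comp (hsr.mono inter_subset_left) fun y hy => hy.2⟩, Subtype.ext (Germ.coe_eq.mpr ?_)⟩
    filter_upwards [hX₀.mem_gen, hU.mem_gen, htend hd.mem_gen] with z hz hzU hzd
    obtain ⟨g, hg, hgz⟩ := horb z hz (s (φ z)) (hsm hzd.1) (hs _ hzd.1).symm
    have := hconst g hg z hzU (by rw [hgz]; exact hzd.2)
    simp [← this, hgz]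

end Quotient

/-! ### Points of projective spaces and proportional vectors -/

section Proportional

variable {V : Type} [AddCommGroup V] [Module ℂ V]

/-- The vectors `v` and `w` differ by a nonzero factor. -/
def Proportional (v w : V) : Prop := ∃ c : ℂ, c ≠ 0 ∧ v = c • w

infix:50 " ∝ " => Proportional

lemma Proportional.refl (v : V) : v ∝ v := ⟨1, one_ne_zero, by simp⟩

lemma Proportional.symm {v w : V} (h : v ∝ w) : w ∝ v := by
  obtain ⟨c, hc, rfl⟩ := h
  exact ⟨c⁻¹, inv_ne_zero hc, by rw [smul_smul, inv_mul_cancel₀ hc, one_smul]⟩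

lemma Proportional.trans {u v w : V} (h : u ∝ v) (h' : v ∝ w) : u ∝ w := by
  obtain ⟨c, hc, rfl⟩ := h
  obtain ⟨d, hd, rfl⟩ := h'
  exact ⟨c * d, mul_ne_zero hc hd, by rw [smul_smul]⟩

lemma Proportional.ne_zero {v w : V} (h : v ∝ w) (hw : w ≠ 0) : v ≠ 0 := by
  obtain ⟨c, hc, rfl⟩ := h
  exact smul_ne_zero hc hw

/-- From here on, identities of projective points become chains of proportionalities between vectors
or matrices, which do not depend on the chosen representatives. -/
lemma represents_iff {v : V} {x : ℙ ℂ V} : Represents v x ↔ v ∝ x.rep := by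
  constructor
  · rintro ⟨hv, rfl⟩
    obtain ⟨a, ha⟩ := Projectivization.exists_smul_eq_mk_rep ℂ v hv
    exact Proportional.symm ⟨a, a.ne_zero, ha.symm⟩
  · intro h
    refine ⟨h.ne_zero x.rep_nonzero, ?_⟩
    obtain ⟨c, hc, h⟩ := h
    conv_rhs => rw [← x.mk_rep]
    rw [Projectivization.mk_eq_mk_iff]
    exact ⟨Units.mk0 c hc, h.symm⟩

variable [Nontrivial V]

lemma represents_toProj {v : V} (hv : v ≠ 0) : Represents v (toProj v) :=
  ⟨hv, by rw [toProj, dif_pos hv]⟩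

lemma toProj_rep {v : V} (hv : v ≠ 0) : (toProj v).rep ∝ v :=
  (represents_iff.mp (represents_toProj hv)).symm

lemma toProj_eq {v : V} {x : ℙ ℂ V} (h : v ∝ x.rep) : toProj v = x := by
  obtain ⟨hv, h⟩ := represents_iff.mpr h
  rw [toProj, dif_pos hv, h]

lemma toProj_congr {v w : V} (h : v ∝ w) (hw : w ≠ 0) : toProj v = toProj w :=
  toProj_eq (h.trans (toProj_rep hw).symm)

end Proportional

/-! ### Matrix algebra up to nonzero scalars -/

section Matrices

variable {k l r : ℕ}

lemma Proportional.mulVec {A B : Matrix (Fin k) (Fin l) ℂ} {v w : Fin l → ℂ} (h : A ∝ B)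
    (h' : v ∝ w) : A *ᵥ v ∝ B *ᵥ w := by
  obtain ⟨c, hc, rfl⟩ := h
  obtain ⟨d, hd, rfl⟩ := h'
  exact ⟨c * d, mul_ne_zero hc hd, by rw [Matrix.mulVec_smul, Matrix.smul_mulVec, smul_smul, mul_comm]⟩

lemma Proportional.mul {A B : Matrix (Fin k) (Fin l) ℂ} {C D : Matrix (Fin l) (Fin r) ℂ} (h : A ∝ B)
    (h' : C ∝ D) : A * C ∝ B * D := by
  obtain ⟨c, hc, rfl⟩ := h
  obtain ⟨d, hd, rfl⟩ := h'
  exact ⟨c * d, mul_ne_zero hc hd, by rw [Matrix.smul_mul, Matrix.mul_smul, smul_smul]⟩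

lemma Proportional.inv {A B : Matrix (Fin k) (Fin k) ℂ} (h : A ∝ B) : A⁻¹ ∝ B⁻¹ := by
  obtain ⟨c, hc, rfl⟩ := h
  by_cases hB : IsUnit B.det
  · refine ⟨c⁻¹, inv_ne_zero hc, ?_⟩
    have := invertibleOfNonzero hc
    rw [Matrix.inv_smul _ _ hB, invOf_eq_inv]
  -- A singular matrix has inverse `0` by convention, so both inverses vanish.
  · refine ⟨1, one_ne_zero, ?_⟩
    rw [Matrix.nonsing_inv_apply_not_isUnit B hB, Matrix.nonsing_inv_apply_not_isUnit, smul_zero]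
    rw [Matrix.det_smul]
    rw [isUnit_iff_ne_zero] at hB ⊢
    simp only [ne_eq, not_not] at hB
    simp [hB]

lemma Proportional.det_ne_zero {A B : Matrix (Fin k) (Fin k) ℂ} (h : A ∝ B) (hB : B.det ≠ 0) :
    A.det ≠ 0 := by
  obtain ⟨c, hc, rfl⟩ := h
  rw [Matrix.det_smul]
  exact mul_ne_zero (pow_ne_zero _ hc) hB

/-- The adjugate is polynomial in the entries; up to scalars it makes inversion a regular map. -/
lemma inv_proportional_adjugate {A : Matrix (Fin k) (Fin k) ℂ} (h : A.det ≠ 0) :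
    A⁻¹ ∝ A.adjugate :=
  ⟨A.det⁻¹, inv_ne_zero h, by rw [Matrix.inv_def, Ring.inverse_eq_inv']⟩

lemma mulVec_ne_zero {A : Matrix (Fin k) (Fin k) ℂ} (h : A.det ≠ 0) {v : Fin k → ℂ} (hv : v ≠ 0) :
    A *ᵥ v ≠ 0 := fun h0 => h (Matrix.exists_mulVec_eq_zero_iff.mp ⟨v, hv, h0⟩)

lemma inv_mulVec_mulVec {A : Matrix (Fin k) (Fin k) ℂ} (h : A.det ≠ 0) (v : Fin k → ℂ) :
    A⁻¹ *ᵥ (A *ᵥ v) = v := by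
  rw [Matrix.mulVec_mulVec, Matrix.nonsing_inv_mul _ h.isUnit, Matrix.one_mulVec]

lemma det_inv_ne_zero {A : Matrix (Fin k) (Fin k) ℂ} (h : A.det ≠ 0) : A⁻¹.det ≠ 0 := by
  rw [Matrix.det_nonsing_inv, Ring.inverse_eq_inv']
  exact inv_ne_zero h

lemma ne_zero_of_det_ne_zero [Nontrivial (Matrix (Fin k) (Fin k) ℂ)]
    {A : Matrix (Fin k) (Fin k) ℂ} (h : A.det ≠ 0) : A ≠ 0 := by
  rintro rfl
  -- The empty matrix is zero and has determinant `1`; nontriviality excludes it.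
  have : Nonempty (Fin k) := by
    by_contra hk
    have := not_nonempty_iff.mp hk
    exact not_subsingleton (Matrix (Fin k) (Fin k) ℂ) inferInstance
  exact h Matrix.det_zero

lemma mul_mul_ne_zero {A : Matrix (Fin k) (Fin k) ℂ} {B : Matrix (Fin k) (Fin l) ℂ}
    {C : Matrix (Fin l) (Fin l) ℂ} (hA : A.det ≠ 0) (hB : B ≠ 0) (hC : C.det ≠ 0) :
    A * B * C ≠ 0 := by
  intro h
  apply hB
  calc B = A⁻¹ * (A * B * C) * C⁻¹ := by
        rw [Matrix.mul_assoc A, Matrix.nonsing_inv_mul_cancel_left _ _ hA.isUnit,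
          Matrix.mul_nonsing_inv_cancel_right _ _ hC.isUnit]
    _ = 0 := by simp [h]

lemma toProj_det_ne_zero [Nontrivial (Matrix (Fin k) (Fin k) ℂ)] {A : Matrix (Fin k) (Fin k) ℂ}
    (h : A.det ≠ 0) : toProj A ∈ PGL k :=
  (toProj_rep (ne_zero_of_det_ne_zero h)).det_ne_zero h

end Matrices

/-! ### Regularity of the maps of linear algebra -/

section LinearMaps

variable {M : Type} [MultiProj M] {k l r : ℕ} {U : Set M}

lemma isRegularMapOn_ofEquiv {V κ : Type} [AddCommGroup V] [Module ℂ V] [Nontrivial V] [Finite κ]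
    (e : V ≃ₗ[ℂ] (κ → ℂ)) {g : M → V} {d : Idx M →₀ ℕ} (hg : ∀ c, IsForm d (fun y => e (g y) c))
    (h : ∀ y ∈ U, g y ≠ 0) :
    let := MultiProj.ofEquiv e
    IsRegularMapOn U (fun y => toProj (g y)) := by
  let := MultiProj.ofEquiv e
  refine IsRegularMapOn.of_isForm (N := ℙ ℂ V) (d := fun _ => d) hg fun y hy => ?_
  obtain ⟨c, hc, h⟩ := (toProj_rep (h y hy)).symm
  refine ⟨fun _ => Units.mk0 c hc, fun i => ?_⟩
  conv_lhs => rw [h, map_smul]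
  rfl

lemma isRegularMapOn_vec [Nontrivial (Fin k → ℂ)] {g : M → Fin k → ℂ} {d : Idx M →₀ ℕ}
    (hg : ∀ i, IsForm d (fun y => g y i)) (h : ∀ y ∈ U, g y ≠ 0) :
    IsRegularMapOn U (fun y => toProj (g y)) :=
  isRegularMapOn_ofEquiv (LinearEquiv.refl ℂ (Fin k → ℂ)) hg h

lemma isRegularMapOn_mat [Nontrivial (Matrix (Fin k) (Fin l) ℂ)] {g : M → Matrix (Fin k) (Fin l) ℂ}
    {d : Idx M →₀ ℕ} (hg : ∀ i j, IsForm d (fun y => g y i j)) (h : ∀ y ∈ U, g y ≠ 0) :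
    IsRegularMapOn U (fun y => toProj (g y)) :=
  isRegularMapOn_ofEquiv (V := Matrix (Fin k) (Fin l) ℂ) (LinearEquiv.curry ℂ ℂ (Fin k) (Fin l)).symm (fun c => hg c.1 c.2) h

lemma isForm_vec (i : Fin k) :
    IsForm (Finsupp.single () 1) (fun x : ℙ ℂ (Fin k → ℂ) => x.rep i) :=
  IsForm.coord (M := ℙ ℂ (Fin k → ℂ)) i

lemma isForm_mat (i : Fin k) (j : Fin l) :
    IsForm (Finsupp.single () 1) (fun x : ℙ ℂ (Matrix (Fin k) (Fin l) ℂ) => x.rep i j) :=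
  IsForm.coord (M := ℙ ℂ (Matrix (Fin k) (Fin l) ℂ)) (i, j)

lemma isForm_mat_fst (N : Type) [MultiProj N] (i : Fin k) (j : Fin l) :
    IsForm (Finsupp.single (Sum.inl () : Unit ⊕ Idx N) 1)
      (fun x : ℙ ℂ (Matrix (Fin k) (Fin l) ℂ) × N => x.1.rep i j) :=
  IsForm.coord (M := ℙ ℂ (Matrix (Fin k) (Fin l) ℂ) × N) (Sum.inl (i, j))

lemma isForm_mat_snd (N : Type) [MultiProj N] (i : Fin k) (j : Fin l) :
    IsForm (Finsupp.single (Sum.inr () : Idx N ⊕ Unit) 1)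
      (fun x : N × ℙ ℂ (Matrix (Fin k) (Fin l) ℂ) => x.2.rep i j) :=
  IsForm.coord (M := N × ℙ ℂ (Matrix (Fin k) (Fin l) ℂ)) (Sum.inr (i, j))

lemma isForm_vec_snd (N : Type) [MultiProj N] (i : Fin k) :
    IsForm (Finsupp.single (Sum.inr () : Idx N ⊕ Unit) 1)
      (fun x : N × ℙ ℂ (Fin k → ℂ) => x.2.rep i) :=
  IsForm.coord (M := N × ℙ ℂ (Fin k → ℂ)) (Sum.inr i)

lemma isForm_vec_pi_fst (N : Type) [MultiProj N] (j : Fin r) (i : Fin k) :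
    IsForm (Finsupp.single (Sum.inl (j, ()) : (Fin r × Unit) ⊕ Idx N) 1)
      (fun x : (Fin r → ℙ ℂ (Fin k → ℂ)) × N => (x.1 j).rep i) :=
  IsForm.coord (M := (Fin r → ℙ ℂ (Fin k → ℂ)) × N) (Sum.inl (j, i))

lemma IsRegularMapOn.mulVec [Nontrivial (Fin k → ℂ)] {f : M → ℙ ℂ (Matrix (Fin k) (Fin l) ℂ)}
    {g : M → ℙ ℂ (Fin l → ℂ)} (hf : IsRegularMapOn U f) (hg : IsRegularMapOn U g)
    (h : ∀ x ∈ U, (f x).rep *ᵥ (g x).rep ≠ 0) :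
    IsRegularMapOn U (fun x => toProj ((f x).rep *ᵥ (g x).rep)) := by
  have key : IsRegularMapOn {z : ℙ ℂ (Matrix (Fin k) (Fin l) ℂ) × ℙ ℂ (Fin l → ℂ) |
      z.1.rep *ᵥ z.2.rep ≠ 0} (fun z => toProj (z.1.rep *ᵥ z.2.rep)) :=
    isRegularMapOn_vec (fun i => IsForm.sum Finset.univ fun j _ =>
      (isForm_mat_fst _ i j).mul (isForm_vec_snd _ j)) fun z hz => hz
  exact (key.comp (hf.prodMk hg) h :)

lemma IsRegularMapOn.mul [Nontrivial (Matrix (Fin k) (Fin r) ℂ)]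
    {f : M → ℙ ℂ (Matrix (Fin k) (Fin l) ℂ)} {g : M → ℙ ℂ (Matrix (Fin l) (Fin r) ℂ)}
    (hf : IsRegularMapOn U f) (hg : IsRegularMapOn U g) (h : ∀ x ∈ U, (f x).rep * (g x).rep ≠ 0) :
    IsRegularMapOn U (fun x => toProj ((f x).rep * (g x).rep)) := by
  have key : IsRegularMapOn {z : ℙ ℂ (Matrix (Fin k) (Fin l) ℂ) × ℙ ℂ (Matrix (Fin l) (Fin r) ℂ) |
      z.1.rep * z.2.rep ≠ 0} (fun z => toProj (z.1.rep * z.2.rep)) :=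
    isRegularMapOn_mat (fun i j => IsForm.sum Finset.univ fun c _ =>
      (isForm_mat_fst _ i c).mul (isForm_mat_snd _ c j)) fun z hz => hz
  exact (key.comp (hf.prodMk hg) h :)

lemma isOpen_PGL : IsOpen (PGL k) :=
  IsForm.isOpen_ne (IsForm.det fun i j => isForm_mat i j)

lemma IsRegularMapOn.inv [Nontrivial (Matrix (Fin k) (Fin k) ℂ)] {f : M → PMat k}
    (hf : IsRegularMapOn U f) (h : MapsTo f U (PGL k)) :
    IsRegularMapOn U (fun x => toProj (f x).rep⁻¹) := by
  have hadj : ∀ z ∈ PGL k, z.rep.adjugate ≠ 0 := fun z hz =>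
    ((inv_proportional_adjugate hz).symm).ne_zero (ne_zero_of_det_ne_zero (det_inv_ne_zero hz))
  suffices key : IsRegularMapOn (PGL k) (fun z => toProj z.rep.adjugate) from
    (key.comp hf h).congr
      fun x hx => (toProj_congr (inv_proportional_adjugate (h hx)) (hadj _ (h hx))).symm
  obtain _ | k := k
  · exact absurd ‹Nontrivial (Matrix (Fin 0) (Fin 0) ℂ)› (not_nontrivial _)
  refine isRegularMapOn_mat (d := k • Finsupp.single () 1) (fun i j => ?_) hadj
  -- An entry of the adjugate is the determinant with column `j` replaced by a constant vector. That
  -- column has degree 0 and the other `k` have degree 1, so all entries have the common degree `k`.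
  have := IsForm.det (d := Function.update (fun _ => Finsupp.single () 1) j 0)
    (A := fun z : PMat (k + 1) => z.repᵀ.updateCol j (Pi.single i 1)) ?_
  · convert this using 1
    · rw [Finset.sum_update_of_mem (Finset.mem_univ _), Finset.sum_const, Finset.card_sdiff]
      simp
    · funext z
      rw [Matrix.adjugate_def, Matrix.of_apply, Matrix.cramer_apply]
  · intro a b
    by_cases hb : b = j
    · subst hb
      simpa using IsForm.const (M := PMat (k + 1)) ((Pi.single i 1 : Fin (k + 1) → ℂ) a)
    · simpa [hb] using isForm_mat (k := k + 1) (l := k + 1) b a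

lemma IsRegularMapOn.redCam {f : M → P3} (hf : IsRegularMapOn U f)
    (h : ∀ x ∈ U, redCam (f x).rep ≠ 0) :
    IsRegularMapOn U (fun x => toProj (redCam (f x).rep)) := by
  have key : IsRegularMapOn {z : P3 | CW.redCam z.rep ≠ 0} (fun z => toProj (CW.redCam z.rep)) := by
    refine isRegularMapOn_mat (d := Finsupp.single () 1) (fun i j => ?_) fun z hz => hz
    fin_cases i <;> fin_cases j <;> first | exact isForm_vec _ | exact IsForm.zero _
  exact (key.comp hf h :)

/-- The parameters of a reduced camera. -/
def camParam (B : Matrix (Fin 3) (Fin 4) ℂ) : Fin 4 → ℂ := ![B 0 0, B 1 1, B 2 2, B 0 3]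

lemma camParam_redCam (a : Fin 4 → ℂ) : camParam (redCam a) = a := by
  ext i
  fin_cases i <;> rfl

lemma IsRegularMapOn.camParam {f : M → P11} (hf : IsRegularMapOn U f)
    (h : ∀ x ∈ U, camParam (f x).rep ≠ 0) :
    IsRegularMapOn U (fun x => toProj (camParam (f x).rep)) := by
  have key : IsRegularMapOn {z : P11 | CW.camParam z.rep ≠ 0}
      (fun z => toProj (CW.camParam z.rep)) := by
    refine isRegularMapOn_vec (d := Finsupp.single () 1) (fun i => ?_) fun z hz => hz
    fin_cases i <;> exact isForm_mat _ _
  exact (key.comp hf h :)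

end LinearMaps

/-! ### Projective frames -/

section Frames

variable {k : ℕ}

/-- The matrix with the given points as columns. -/
def colMat (v : Fin k → ℙ ℂ (Fin k → ℂ)) : Matrix (Fin k) (Fin k) ℂ :=
  Matrix.of fun i j => (v j).rep i

/-- The `k + 1` points are in general position. -/
def frames (k : ℕ) : Set ((Fin k → ℙ ℂ (Fin k → ℂ)) × ℙ ℂ (Fin k → ℂ)) :=
  {z | (colMat z.1).det ≠ 0 ∧ ∀ j, (colMat z.1).cramer z.2.rep j ≠ 0}

/-- A matrix that sends the standard frame to the given one. -/
def frameMat (z : (Fin k → ℙ ℂ (Fin k → ℂ)) × ℙ ℂ (Fin k → ℂ)) : Matrix (Fin k) (Fin k) ℂ :=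
  colMat z.1 * Matrix.diagonal ((colMat z.1).cramer z.2.rep)

lemma colMat_mulVec_single (v : Fin k → ℙ ℂ (Fin k → ℂ)) (j : Fin k) :
    colMat v *ᵥ Pi.single j 1 = (v j).rep := by
  ext i
  simp [colMat]

lemma frameMat_mulVec_single {z : (Fin k → ℙ ℂ (Fin k → ℂ)) × ℙ ℂ (Fin k → ℂ)} (hz : z ∈ frames k)
    (j : Fin k) : frameMat z *ᵥ Pi.single j 1 ∝ (z.1 j).rep := by
  refine ⟨_, hz.2 j, ?_⟩
  rw [frameMat, ← Matrix.mulVec_mulVec, Matrix.diagonal_mulVec_single, mul_one,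
    ← colMat_mulVec_single, ← Matrix.mulVec_smul, ← Pi.single_smul, smul_eq_mul, mul_one]

/-- By Cramer's rule the diagonal weights are the determinant times the coordinates of the last
point in the basis of columns, so the weighted columns add up to a multiple of that point. -/
lemma frameMat_mulVec_one {z : (Fin k → ℙ ℂ (Fin k → ℂ)) × ℙ ℂ (Fin k → ℂ)} (hz : z ∈ frames k) :
    frameMat z *ᵥ (fun _ => 1) ∝ z.2.rep := by
  refine ⟨_, hz.1, ?_⟩
  rw [frameMat, ← Matrix.mulVec_mulVec, ← Matrix.mulVec_cramer]
  congr 1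
  ext i
  simp [Matrix.mulVec_diagonal]

lemma frameMat_det_ne_zero {z : (Fin k → ℙ ℂ (Fin k → ℂ)) × ℙ ℂ (Fin k → ℂ)} (hz : z ∈ frames k) :
    (frameMat z).det ≠ 0 := by
  rw [frameMat, Matrix.det_mul, Matrix.det_diagonal]
  exact mul_ne_zero hz.1 (Finset.prod_ne_zero_iff.mpr fun j _ => hz.2 j)

/-- A matrix that sends the standard frame to `z` is proportional to `frameMat z`. -/
lemma frameMat_unique {z : (Fin k → ℙ ℂ (Fin k → ℂ)) × ℙ ℂ (Fin k → ℂ)}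
    {A : Matrix (Fin k) (Fin k) ℂ} (hA : A.det ≠ 0)
    (h : ∀ j, A *ᵥ Pi.single j 1 ∝ (z.1 j).rep) (h1 : A *ᵥ (fun _ => 1) ∝ z.2.rep) :
    z ∈ frames k ∧ frameMat z ∝ A := by
  choose α hα hαz using fun j => (h j).symm
  obtain ⟨β, hβ, hβz⟩ := h1.symm
  have hcol : colMat z.1 = A * Matrix.diagonal α := by
    ext i j
    have := congrFun (hαz j) i
    simp only [Pi.smul_apply, Matrix.mulVec_single_one, smul_eq_mul, Matrix.col_apply] at this
    simp [colMat, this, mul_comm]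
  have hdet : (colMat z.1).det ≠ 0 := by
    rw [hcol, Matrix.det_mul, Matrix.det_diagonal]
    exact mul_ne_zero hA (Finset.prod_ne_zero_iff.mpr fun j _ => hα j)
  -- The columns of `A` are those of `colMat z.1` up to the factors `α`. Expanding the last point in
  -- both ways shows that the Cramer weights are inverse to `α` up to one common constant; this
  -- gives both general position and proportionality.
  have hcr : ∀ j, α j * (colMat z.1).cramer z.2.rep j = (colMat z.1).det * β := by
    have h2 : A *ᵥ (Matrix.diagonal α *ᵥ (colMat z.1).cramer z.2.rep) =
        A *ᵥ (((colMat z.1).det * β) • fun _ => 1) := by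
      rw [Matrix.mulVec_mulVec, ← hcol, Matrix.mulVec_cramer, Matrix.mulVec_smul, ← smul_smul, ← hβz]
    have h3 := congrArg (A⁻¹ *ᵥ ·) h2
    simp only [inv_mulVec_mulVec hA] at h3
    intro j
    have h4 := congrFun h3 j
    rw [Matrix.mulVec_diagonal] at h4
    simpa using h4
  have hc : (colMat z.1).det * β ≠ 0 := mul_ne_zero hdet hβ
  refine ⟨⟨hdet, fun j h0 => hc (by rw [← hcr j, h0, mul_zero])⟩, _, hc, ?_⟩
  rw [frameMat]
  conv_lhs => rw [hcol, Matrix.mul_assoc, Matrix.diagonal_mul_diagonal]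
  rw [← hcol]
  simp_rw [hcr]
  ext i j
  simp [mul_comm]

lemma isForm_cramer (j : Fin k) :
    IsForm (M := (Fin k → ℙ ℂ (Fin k → ℂ)) × ℙ ℂ (Fin k → ℂ))
      (∑ i, Function.update (fun i : Fin k => Finsupp.single (Sum.inl (i, ())) 1) j
        (Finsupp.single (Sum.inr ()) 1) i)
      (fun z => (colMat z.1).cramer z.2.rep j) := by
  simp_rw [Matrix.cramer_apply]
  refine IsForm.det fun a b => ?_
  by_cases hb : b = j
  · subst hb
    simpa using isForm_vec_snd (Fin k → ℙ ℂ (Fin k → ℂ)) a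
  · simpa [hb, colMat] using isForm_vec_pi_fst (ℙ ℂ (Fin k → ℂ)) b a

lemma isOpen_frames : IsOpen (frames k) := by
  have h1 : IsOpen {z : (Fin k → ℙ ℂ (Fin k → ℂ)) × ℙ ℂ (Fin k → ℂ) | (colMat z.1).det ≠ 0} :=
    IsForm.isOpen_ne (IsForm.det fun a b => isForm_vec_pi_fst (ℙ ℂ (Fin k → ℂ)) b a)
  have h2 := isOpen_iInter_of_finite fun j : Fin k => (isForm_cramer j).isOpen_ne
  convert h1.inter h2 using 1
  ext z
  simp [frames]

/-- The `j`-th Cramer weight is linear in the last point and in all columns except the `j`-th, which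
is the one it multiplies. So every entry of `frameMat` has degree one in each of the `k + 1` points.
-/
lemma IsRegularMapOn.frame {M : Type} [MultiProj M] {U : Set M}
    [Nontrivial (Matrix (Fin k) (Fin k) ℂ)] {f : M → Fin k → ℙ ℂ (Fin k → ℂ)}
    {g : M → ℙ ℂ (Fin k → ℂ)} (hf : IsRegularMapOn U f) (hg : IsRegularMapOn U g)
    (h : ∀ x ∈ U, (f x, g x) ∈ frames k) :
    IsRegularMapOn U (fun x => toProj (frameMat (f x, g x))) := by
  have key : IsRegularMapOn (frames k) (fun z => toProj (frameMat z)) := by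
    refine isRegularMapOn_mat (d := Finsupp.single (Sum.inr ()) 1 +
      ∑ i : Fin k, Finsupp.single (Sum.inl (i, ())) 1) (fun i j => ?_)
      fun z hz => ne_zero_of_det_ne_zero (frameMat_det_ne_zero hz)
    convert (isForm_cramer j).mul (isForm_vec_pi_fst (ℙ ℂ (Fin k → ℂ)) j i) using 1
    · rw [Finset.sum_update_of_mem (Finset.mem_univ _), add_assoc]
      congr 1
      rw [Finset.sdiff_singleton_eq_erase, Finset.sum_erase_add _ _ (Finset.mem_univ j)]
    · funext z
      simp only [frameMat, Matrix.mul_diagonal]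
      rw [mul_comm]
      rfl
  exact (key.comp (hf.prodMk hg) h :)

end Frames

/-! ### Correspondences defined by families of cameras -/

lemma IsRegularMapOn.continuous {M N : Type} [MultiProj M] [MultiProj N] {f : M → N}
    (hf : IsRegularMapOn univ f) : Continuous f :=
  continuousOn_univ.mp hf.continuousOn

/-- The chosen coordinates of `φ x` must be forms exactly, not up to units; projections from
products satisfy this. -/
lemma IsForm.comp {M N : Type} [MultiProj M] [MultiProj N] {f : N → ℂ} {d : Idx N →₀ ℕ}
    (hf : IsForm d f) {φ : M → N} {e : Idx N → (Idx M →₀ ℕ)}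
    (hφ : ∀ c, IsForm (e (grp c)) (fun x => rep (φ x) c)) :
    IsForm (d.sum fun i k => k • e i) (fun x => f (φ x)) := by
  obtain ⟨F, hF, hf⟩ := hf
  choose G hG hφ using hφ
  refine ⟨MvPolynomial.bind₁ G F, hF.bind hG, fun x => ?_⟩
  rw [evalAt_bind]
  simp_rw [hφ]
  exact hf (φ x)

lemma proportional_of_mul_eq_mul {k : ℕ} {v w : Fin k → ℂ} (hv : v ≠ 0) (hw : w ≠ 0)
    (h : ∀ a b, v a * w b = v b * w a) : v ∝ w := by
  obtain ⟨b, hb⟩ := Function.ne_iff.mp hw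
  simp only [Pi.zero_apply] at hb
  have hvw : v = (v b / w b) • w := by
    ext a
    simp only [Pi.smul_apply, smul_eq_mul]
    field_simp
    exact h a b
  refine ⟨v b / w b, fun h0 => hv ?_, hvw⟩
  rw [hvw, h0, zero_smul]

section Correspondences

variable {C : Type} [MultiProj C] {β : C → Matrix (Fin 3) (Fin 4) ℂ} {d : Idx C →₀ ℕ} {m n : ℕ}

/-- The cameras, points and images with all images defined and correct. -/
def graphSet (β : C → Matrix (Fin 3) (Fin 4) ℂ) (m n : ℕ) :
    Set ((Fin m → C) × (Fin n → P3) × (Fin m → Fin n → P2)) :=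
  {x | ∀ i j, Represents (β (x.1 i) *ᵥ (x.2.1 j).rep) (x.2.2 i j)}

lemma isForm_image (hβ : ∀ a b, IsForm d (fun c => β c a b)) (a : Fin 3) :
    IsForm ((d.sum fun i k => k • Finsupp.single (Sum.inl i : Idx C ⊕ Unit) 1) +
      Finsupp.single (Sum.inr ()) 1) (fun z : C × P3 => (β z.1 *ᵥ z.2.rep) a) :=
  IsForm.sum Finset.univ fun b _ => ((hβ a b).comp (φ := fun z : C × P3 => z.1)
    fun c => IsForm.coord (M := C × P3) (Sum.inl c)).mul (isForm_vec_snd C b)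

lemma isOpen_image_ne_zero (hβ : ∀ a b, IsForm d (fun c => β c a b)) :
    IsOpen {z : C × P3 | β z.1 *ᵥ z.2.rep ≠ 0} := by
  convert isOpen_iUnion fun a => (isForm_image hβ a).isOpen_ne using 1
  ext z
  simp [Function.ne_iff]

lemma isClosed_image_eq (hβ : ∀ a b, IsForm d (fun c => β c a b)) (a b : Fin 3) :
    IsClosed {z : (C × P3) × P2 |
      (β z.1.1 *ᵥ z.1.2.rep) a * z.2.rep b = (β z.1.1 *ᵥ z.1.2.rep) b * z.2.rep a} := by
  have h : ∀ a b : Fin 3, IsForm _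
      (fun z : (C × P3) × P2 => (β z.1.1 *ᵥ z.1.2.rep) a * z.2.rep b) := fun a b =>
    ((isForm_image hβ a).comp (φ := fun z : (C × P3) × P2 => z.1)
      (e := fun i => Finsupp.single (Sum.inl i : Idx (C × P3) ⊕ Unit) 1)
      fun c => IsForm.coord (M := (C × P3) × P2) (Sum.inl c)).mul (isForm_vec_snd (C × P3) b)
  exact (h a b).isClosed_eq (h b a)

/-- The pairs of cameras and points for which all images are defined. -/
def imageDomain (β : C → Matrix (Fin 3) (Fin 4) ℂ) (m n : ℕ) : Set ((Fin m → C) × (Fin n → P3)) :=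
  {z | ∀ i j, β (z.1 i) *ᵥ (z.2 j).rep ≠ 0}

lemma isOpen_imageDomain (hβ : ∀ a b, IsForm d (fun c => β c a b)) :
    IsOpen (imageDomain β m n) := by
  have h : ∀ i j, IsOpen {z : (Fin m → C) × (Fin n → P3) | β (z.1 i) *ᵥ (z.2 j).rep ≠ 0} :=
    fun i j => (isOpen_image_ne_zero hβ).preimage
      (((IsRegularMapOn.fst' univ).eval i).prodMk ((IsRegularMapOn.snd' univ).eval j)).continuous
  convert isOpen_iInter_of_finite fun i => isOpen_iInter_of_finite (h i) using 1
  ext z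
  simp [imageDomain]

/-- The images are determined by cameras and points, so the set is the image, under a regular map,
of a nonempty open subset of a multiprojective space. -/
lemma isIrreducible_graphSet (hβ : ∀ a b, IsForm d (fun c => β c a b))
    (hne : ∃ (c : C) (q : P3), β c *ᵥ q.rep ≠ 0) : IsIrreducible (graphSet β m n) := by
  have himg : graphSet β m n = (fun z : (Fin m → C) × (Fin n → P3) =>
      (z.1, z.2, fun i j => toProj (β (z.1 i) *ᵥ (z.2 j).rep))) '' imageDomain β m n := by
    ext x
    constructor
    · intro hx
      refine ⟨(x.1, x.2.1), fun i j => (hx i j).1, ?_⟩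
      refine Prod.ext rfl (Prod.ext rfl (funext fun i => funext fun j => ?_))
      exact toProj_eq (represents_iff.mp (hx i j))
    · rintro ⟨z, hz, rfl⟩ i j
      exact represents_toProj (hz i j)
  obtain ⟨c, q, hcq⟩ := hne
  have key : IsRegularMapOn {z : C × P3 | β z.1 *ᵥ z.2.rep ≠ 0}
      (fun z => toProj (β z.1 *ᵥ z.2.rep)) :=
    isRegularMapOn_vec (isForm_image hβ) fun z hz => hz
  rw [himg]
  refine isIrreducible_image (isIrreducible_of_isOpen (isOpen_imageDomain hβ)
    ⟨(fun _ => c, fun _ => q), fun _ _ => hcq⟩) ?_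
  refine (IsRegularMapOn.fst' _).prodMk ((IsRegularMapOn.snd' _).prodMk (.pi fun i => .pi fun j => ?_))
  exact (key.comp (((IsRegularMapOn.fst' _).eval i).prodMk ((IsRegularMapOn.snd' _).eval j))
    (fun z (hz : z ∈ imageDomain β m n) => hz i j) :)

lemma isVariety_zclosure {M : Type} [MultiProj M] {X : Set M} (hX : IsIrreducible X) :
    IsVariety (zclosure X) :=
  ⟨(isClosed_closure (s := X)).isLocallyClosed, hX.1.mono subset_closure, hX.2.closure⟩

/-- A configuration in the closure is a correct one as soon as all images are defined. -/
lemma isDenseOpenIn_graphSet (hβ : ∀ a b, IsForm d (fun c => β c a b)) :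
    IsDenseOpenIn (zclosure (graphSet β m n)) (graphSet β m n) := by
  refine ⟨⟨{x | (x.1, x.2.1) ∈ imageDomain β m n}, (isOpen_imageDomain hβ).preimage
    ((IsRegularMapOn.fst' univ).prodMk (IsRegularMapOn.snd' univ).fst).continuous, ?_⟩, subset_rfl⟩
  refine Subset.antisymm (fun x hx => ⟨subset_closure hx, fun i j => (hx i j).1⟩) ?_
  rintro x ⟨hx, hxO⟩ i j
  refine represents_iff.mpr (proportional_of_mul_eq_mul (hxO i j) (x.2.2 i j).rep_nonzero
    fun a b => ?_)
  -- The minors of the computed image against the recorded one vanish on a closed set, hence on the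
  -- closure; when the computed image is nonzero this is proportionality.
  have hcl := (isClosed_image_eq hβ a b).preimage ((((IsRegularMapOn.fst' univ).eval i).prodMk
    ((IsRegularMapOn.snd' univ).fst.eval j)).prodMk
      (((IsRegularMapOn.snd' univ).snd.eval i).eval j)).continuous
    (X := (Fin m → C) × (Fin n → P3) × (Fin m → Fin n → P2))
  refine closure_minimal (fun y hy => ?_) hcl hx
  obtain ⟨c, -, hc⟩ := represents_iff.mp (hy i j)
  simp only [mem_preimage]
  change (β (y.1 i) *ᵥ (y.2.1 j).rep) a * (y.2.2 i j).rep b =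
    (β (y.1 i) *ᵥ (y.2.1 j).rep) b * (y.2.2 i j).rep a
  rw [hc]
  simp only [Pi.smul_apply, smul_eq_mul]
  ring

end Correspondences

/-! ### The two correspondences as varieties -/

lemma isForm_redCam (a : Fin 3) (b : Fin 4) :
    IsForm (Finsupp.single () 1) (fun x : P3 => redCam x.rep a b) := by
  fin_cases a <;> fin_cases b <;> first | exact isForm_vec _ | exact IsForm.zero _

lemma isIrreducible_graphSet_image (m n : ℕ) :
    IsIrreducible (graphSet (fun A : P11 => A.rep) m n) := by
  refine isIrreducible_graphSet isForm_mat ⟨toProj (fun _ _ => 1), toProj (Pi.single 0 1), ?_⟩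
  have h1 : (Matrix.of fun _ _ => 1 : Matrix (Fin 3) (Fin 4) ℂ) ≠ 0 := fun h => by
    simpa using congrFun (congrFun h 0) 0
  have h2 : (Pi.single 0 1 : Fin 4 → ℂ) ≠ 0 := fun h => by simpa using congrFun h 0
  refine ((toProj_rep h1).mulVec (toProj_rep h2)).ne_zero fun h => ?_
  simpa using congrFun h 0

lemma isIrreducible_graphSet_red (m n : ℕ) :
    IsIrreducible (graphSet (fun a : P3 => redCam a.rep) m n) := by
  have h2 : (Pi.single 0 1 : Fin 4 → ℂ) ≠ 0 := fun h => by simpa using congrFun h 0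
  refine isIrreducible_graphSet isForm_redCam ⟨toProj (Pi.single 0 1), toProj (Pi.single 0 1), ?_⟩
  obtain ⟨c, hc, h⟩ := toProj_rep h2
  rw [h]
  intro h
  simpa [redCam, Matrix.mulVec, dotProduct, Fin.sum_univ_four, hc] using congrFun h 0

lemma isVariety_imageCorr (m n : ℕ) : IsVariety (imageCorr m n) :=
  isVariety_zclosure (isIrreducible_graphSet_image m n)

lemma isVariety_redCorr (m n : ℕ) : IsVariety (redCorr m n) :=
  isVariety_zclosure (isIrreducible_graphSet_red m n)

/-! ### The group -/

section Group

variable {k m n : ℕ}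

lemma ones_ne_zero [NeZero k] : (fun _ => 1 : Fin k → ℂ) ≠ 0 := fun h => by
  simpa using congrFun h 0

lemma mem_stabE5_iff {S : PMat 4} :
    S ∈ stabE5 ↔ S.rep.det ≠ 0 ∧ S.rep *ᵥ (fun _ => 1) ∝ (fun _ => 1) := by
  refine and_congr_right fun _ => ?_
  rw [represents_iff]
  have h := toProj_rep (ones_ne_zero (k := 4))
  exact ⟨fun h' => h'.trans h, fun h' => h'.trans h.symm⟩

lemma toProj_mem_stabE5 {A : Matrix (Fin 4) (Fin 4) ℂ} (hA : A.det ≠ 0)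
    (h : A *ᵥ (fun _ => 1) ∝ (fun _ => 1)) : toProj A ∈ stabE5 := by
  have hr := toProj_rep (ne_zero_of_det_ne_zero hA)
  exact mem_stabE5_iff.mpr ⟨hr.det_ne_zero hA, (hr.mulVec (.refl _)).trans h⟩

lemma mul_det_ne_zero {A B : Matrix (Fin k) (Fin k) ℂ} (hA : A.det ≠ 0) (hB : B.det ≠ 0) :
    (A * B).det ≠ 0 := by
  rw [Matrix.det_mul]
  exact mul_ne_zero hA hB

lemma mulVec_proportional_inv {A : Matrix (Fin k) (Fin k) ℂ} (hA : A.det ≠ 0) {v w : Fin k → ℂ}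
    (h : A *ᵥ v ∝ w) : v ∝ A⁻¹ *ᵥ w := by
  have := (Proportional.refl A⁻¹).mulVec h
  rwa [inv_mulVec_mulVec hA] at this

lemma rep_mulG {g h : GAmb m} (hg : g ∈ grpG m) (hh : h ∈ grpG m) :
    (∀ i, ((mulG m g h).1 i).rep ∝ (g.1 i).rep * (h.1 i).rep) ∧
      (mulG m g h).2.rep ∝ g.2.rep * h.2.rep :=
  ⟨fun i => toProj_rep (ne_zero_of_det_ne_zero (mul_det_ne_zero (hg.1 i) (hh.1 i))),
    toProj_rep (ne_zero_of_det_ne_zero (mul_det_ne_zero hg.2.1 hh.2.1))⟩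

lemma rep_invG {g : GAmb m} (hg : g ∈ grpG m) :
    (∀ i, ((invG m g).1 i).rep ∝ (g.1 i).rep⁻¹) ∧ (invG m g).2.rep ∝ g.2.rep⁻¹ :=
  ⟨fun i => toProj_rep (ne_zero_of_det_ne_zero (det_inv_ne_zero (hg.1 i))),
    toProj_rep (ne_zero_of_det_ne_zero (det_inv_ne_zero hg.2.1))⟩

lemma rep_oneG (m : ℕ) : (∀ i, ((oneG m).1 i).rep ∝ 1) ∧ (oneG m).2.rep ∝ 1 :=
  ⟨fun _ => toProj_rep one_ne_zero, toProj_rep one_ne_zero⟩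

lemma mulG_mem {g h : GAmb m} (hg : g ∈ grpG m) (hh : h ∈ grpG m) : mulG m g h ∈ grpG m := by
  refine ⟨fun i => toProj_det_ne_zero (mul_det_ne_zero (hg.1 i) (hh.1 i)),
    toProj_mem_stabE5 (mul_det_ne_zero hg.2.1 hh.2.1) ?_⟩
  rw [← Matrix.mulVec_mulVec]
  exact ((Proportional.refl _).mulVec (mem_stabE5_iff.mp hh.2).2).trans (mem_stabE5_iff.mp hg.2).2

lemma invG_mem {g : GAmb m} (hg : g ∈ grpG m) : invG m g ∈ grpG m :=
  ⟨fun i => toProj_det_ne_zero (det_inv_ne_zero (hg.1 i)),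
    toProj_mem_stabE5 (det_inv_ne_zero hg.2.1)
      (mulVec_proportional_inv hg.2.1 (mem_stabE5_iff.mp hg.2).2).symm⟩

lemma oneG_mem (m : ℕ) : oneG m ∈ grpG m :=
  ⟨fun _ => toProj_det_ne_zero (by simp),
    toProj_mem_stabE5 (by simp) (by rw [Matrix.one_mulVec]; exact .refl _)⟩

lemma isOpen_PGLPow (n : ℕ) : IsOpen (PGLPow n) := by
  have h : ∀ i, IsOpen {T : Fin n → PMat 3 | T i ∈ PGL 3} := fun i =>
    isOpen_PGL.preimage (IsRegularMapOn.eval' univ i).continuous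
  convert isOpen_iInter_of_finite h using 1
  ext T
  simp [PGLPow]

lemma isIrreducible_PGLPow (n : ℕ) : IsIrreducible (PGLPow n) :=
  isIrreducible_of_isOpen (isOpen_PGLPow n) ⟨(oneG n).1, (oneG_mem n).1⟩

/-- An element of the stabilizer is determined by the images of the four coordinate points, and
these can be any points in general position with `E5`. So the group is a regular image of an open
subset of (ℙ³)⁴. -/
lemma isIrreducible_stabE5 : IsIrreducible stabE5 := by
  let E : P3 := toProj fun _ => 1
  have hE : E.rep ∝ fun _ => 1 := toProj_rep ones_ne_zero
  have himg : stabE5 = (fun v : Fin 4 → P3 => toProj (frameMat (v, E))) ''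
      {v | (v, E) ∈ frames 4} := by
    ext S
    constructor
    · intro hS
      obtain ⟨hdet, h1⟩ := mem_stabE5_iff.mp hS
      have hv : ∀ j : Fin 4, S.rep *ᵥ Pi.single j 1 ≠ 0 := fun j =>
        mulVec_ne_zero hdet fun h => by simpa using congrFun h j
      obtain ⟨hz, hS'⟩ := frameMat_unique (z := (fun j => toProj (S.rep *ᵥ Pi.single j 1), E)) hdet
        (fun j => (toProj_rep (hv j)).symm) (h1.trans hE.symm)
      exact ⟨_, hz, toProj_eq hS'⟩
    · rintro ⟨v, hv, rfl⟩
      exact toProj_mem_stabE5 (frameMat_det_ne_zero hv) ((frameMat_mulVec_one hv).trans hE)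
  have hne : stabE5.Nonempty := ⟨_, (oneG_mem 0).2⟩
  have hr := (IsRegularMapOn.id (M := Fin 4 → P3) univ).prodMk (IsRegularMapOn.const univ E)
  rw [himg] at hne ⊢
  refine isIrreducible_image (isIrreducible_of_isOpen (isOpen_frames.preimage hr.continuous)
    hne.of_image) ?_
  exact (IsRegularMapOn.id _).frame (IsRegularMapOn.const _ E) fun v hv => hv

lemma isIrreducible_grpG (m : ℕ) : IsIrreducible (grpG m) :=
  isIrreducible_prod (isIrreducible_PGLPow m) isIrreducible_stabE5

lemma isLocallyClosed_grpG (m : ℕ) : IsLocallyClosed (grpG m) := by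
  have hform : ∀ i, IsForm (Finsupp.single () 1) (fun S : PMat 4 => (S.rep *ᵥ fun _ => 1) i) := by
    intro i
    simp only [Matrix.mulVec, dotProduct, mul_one]
    exact IsForm.sum Finset.univ fun j _ => isForm_mat i j
  -- For an invertible `S`, fixing [1:1:1:1] means that all row sums are equal, which is a closed
  -- linear condition.
  have hc : IsClosed {S : PMat 4 | ∀ i j, (S.rep *ᵥ fun _ => 1) i = (S.rep *ᵥ fun _ => 1) j} := by
    convert isClosed_iInter fun i => isClosed_iInter fun j => (hform i).isClosed_eq (hform j) using 1
    ext S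
    simp
  refine ⟨{g | g.1 ∈ PGLPow m} ∩ {g | g.2 ∈ PGL 4}, _,
    ((isOpen_PGLPow m).preimage (IsRegularMapOn.fst' univ).continuous).inter
      (isOpen_PGL.preimage (IsRegularMapOn.snd' univ).continuous),
    hc.preimage (IsRegularMapOn.snd' univ).continuous, ?_⟩
  ext g
  constructor
  · rintro ⟨h1, h2⟩
    refine ⟨⟨h1, h2.1⟩, fun i j => ?_⟩
    obtain ⟨c, -, hc⟩ := (mem_stabE5_iff.mp h2).2
    rw [hc]
    rfl
  · rintro ⟨⟨h1, h2⟩, h3⟩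
    exact ⟨h1, mem_stabE5_iff.mpr ⟨h2, proportional_of_mul_eq_mul (mulVec_ne_zero h2 ones_ne_zero)
      ones_ne_zero fun a b => by rw [h3 a b]⟩⟩

lemma isVariety_grpG (m : ℕ) : IsVariety (grpG m) := ⟨isLocallyClosed_grpG m, isIrreducible_grpG m⟩

lemma isAlgebraicGroup_grpG (m : ℕ) :
    IsAlgebraicGroup (grpG m) (mulG m) (invG m) (oneG m) where
  locallyClosed := isLocallyClosed_grpG m
  mul_morphism := by
    refine ⟨fun x hx => mulG_mem hx.1 hx.2, .prodMk (.pi fun i => ?_) ?_⟩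
    · exact ((IsRegularMapOn.fst' _).fst.eval i).mul ((IsRegularMapOn.snd' _).fst.eval i)
        fun x hx => ne_zero_of_det_ne_zero (mul_det_ne_zero (hx.1.1 i) (hx.2.1 i))
    · exact (IsRegularMapOn.fst' _).snd.mul (IsRegularMapOn.snd' _).snd
        fun x hx => ne_zero_of_det_ne_zero (mul_det_ne_zero hx.1.2.1 hx.2.2.1)
  inv_morphism := by
    refine ⟨fun x hx => invG_mem hx, .prodMk (.pi fun i => ?_) ?_⟩
    · exact ((IsRegularMapOn.fst' _).eval i).inv fun x hx => hx.1 i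
    · exact (IsRegularMapOn.snd' _).inv fun x hx => hx.2.1
  one_mem := oneG_mem m
  mul_assoc := by
    intro a ha b hb c hc
    have h1 := rep_mulG ha hb
    have h2 := rep_mulG hb hc
    refine Prod.ext (funext fun i => toProj_congr ?_ ?_) (toProj_congr ?_ ?_)
    · refine ((h1.1 i).mul (.refl _)).trans ?_
      rw [Matrix.mul_assoc]
      exact (Proportional.refl _).mul (h2.1 i).symm
    · exact ne_zero_of_det_ne_zero (mul_det_ne_zero (ha.1 i) ((mulG_mem hb hc).1 i))
    · refine (h1.2.mul (.refl _)).trans ?_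
      rw [Matrix.mul_assoc]
      exact (Proportional.refl _).mul h2.2.symm
    · exact ne_zero_of_det_ne_zero (mul_det_ne_zero ha.2.1 (mulG_mem hb hc).2.1)
  one_mul := by
    intro a _
    refine Prod.ext (funext fun i => toProj_eq ?_) (toProj_eq ?_)
    · simpa using ((rep_oneG m).1 i).mul (.refl (a.1 i).rep)
    · simpa using (rep_oneG m).2.mul (.refl a.2.rep)
  inv_mul := by
    intro a ha
    refine Prod.ext (funext fun i => toProj_congr ?_ one_ne_zero) (toProj_congr ?_ one_ne_zero)
    · simpa [Matrix.nonsing_inv_mul _ (ha.1 i : (a.1 i).rep.det ≠ 0).isUnit] using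
        ((rep_invG ha).1 i).mul (.refl (a.1 i).rep)
    · simpa [Matrix.nonsing_inv_mul _ (ha.2.1 : a.2.rep.det ≠ 0).isUnit] using
        (rep_invG ha).2.mul (.refl a.2.rep)

/-! ### The action -/

lemma rep_actG {g : GAmb m} (hg : g ∈ grpG m) (x : Amb m n) :
    (∀ i, ((actG m n g x).1 i).rep ∝ (g.1 i).rep * (x.1 i).rep * g.2.rep⁻¹) ∧
    (∀ j, ((actG m n g x).2.1 j).rep ∝ g.2.rep *ᵥ (x.2.1 j).rep) ∧
    (∀ i j, ((actG m n g x).2.2 i j).rep ∝ (g.1 i).rep *ᵥ (x.2.2 i j).rep) :=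
  ⟨fun i => toProj_rep (mul_mul_ne_zero (hg.1 i) (x.1 i).rep_nonzero (det_inv_ne_zero hg.2.1)),
    fun j => toProj_rep (mulVec_ne_zero hg.2.1 (x.2.1 j).rep_nonzero),
    fun i j => toProj_rep (mulVec_ne_zero (hg.1 i) (x.2.2 i j).rep_nonzero)⟩

lemma eq_of_rep {x y : Amb m n} (h1 : ∀ i, (x.1 i).rep ∝ (y.1 i).rep)
    (h2 : ∀ j, (x.2.1 j).rep ∝ (y.2.1 j).rep) (h3 : ∀ i j, (x.2.2 i j).rep ∝ (y.2.2 i j).rep) :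
    x = y := by
  have key : ∀ {V : Type} [AddCommGroup V] [Module ℂ V] {a b : ℙ ℂ V}, a.rep ∝ b.rep → a = b := by
    intro V _ _ a b h
    obtain ⟨hv, h⟩ := represents_iff.mpr h
    rw [← h, a.mk_rep]
  exact Prod.ext (funext fun i => key (h1 i)) (Prod.ext (funext fun j => key (h2 j))
    (funext fun i => funext fun j => key (h3 i j)))

lemma actG_oneG (x : Amb m n) : actG m n (oneG m) x = x := by
  obtain ⟨h1, h2, h3⟩ := rep_actG (oneG_mem m) x
  obtain ⟨e1, e2⟩ := rep_oneG m
  refine eq_of_rep (fun i => (h1 i).trans ?_) (fun j => (h2 j).trans ?_)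
    fun i j => (h3 i j).trans ?_
  · simpa using ((e1 i).mul (.refl (x.1 i).rep)).mul e2.inv
  · simpa using e2.mulVec (.refl (x.2.1 j).rep)
  · simpa using (e1 i).mulVec (.refl (x.2.2 i j).rep)

/-- Invertible matrices never produce the zero vector, so the action laws hold on the whole ambient
space and not just generically. -/
lemma actG_mulG {g h : GAmb m} (hg : g ∈ grpG m) (hh : h ∈ grpG m) (x : Amb m n) :
    actG m n (mulG m g h) x = actG m n g (actG m n h x) := by
  obtain ⟨h1, h2, h3⟩ := rep_actG (mulG_mem hg hh) x
  obtain ⟨k1, k2, k3⟩ := rep_actG hh x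
  obtain ⟨l1, l2, l3⟩ := rep_actG hg (actG m n h x)
  obtain ⟨e1, e2⟩ := rep_mulG hg hh
  refine eq_of_rep (fun i => (h1 i).trans (.trans ?_ (l1 i).symm))
    (fun j => (h2 j).trans (.trans ?_ (l2 j).symm)) fun i j => (h3 i j).trans (.trans ?_ (l3 i j).symm)
  · refine (((e1 i).mul (.refl _)).mul e2.inv).trans ?_
    refine .trans ?_ (((Proportional.refl _).mul (k1 i)).mul (.refl _)).symm
    rw [Matrix.mul_inv_rev]
    simp only [Matrix.mul_assoc]
    exact .refl _
  · refine (e2.mulVec (.refl _)).trans ?_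
    rw [← Matrix.mulVec_mulVec]
    exact (Proportional.refl _).mulVec (k2 j).symm
  · refine ((e1 i).mulVec (.refl _)).trans ?_
    rw [← Matrix.mulVec_mulVec]
    exact (Proportional.refl _).mulVec (k3 i j).symm

lemma isRegularMapOn_actG {K : Type} [MultiProj K] {U : Set K} {f : K → GAmb m} {g : K → Amb m n}
    (hf : IsRegularMapOn U f) (hg : IsRegularMapOn U g) (hfm : MapsTo f U (grpG m)) :
    IsRegularMapOn U (fun x => actG m n (f x) (g x)) := by
  refine .prodMk (.pi fun i => ?_) (.prodMk (.pi fun j => ?_) (.pi fun i => .pi fun j => ?_))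
  · have hTA : ∀ x ∈ U, ((f x).1 i).rep * ((g x).1 i).rep ≠ 0 := fun x hx => by
      simpa using mul_mul_ne_zero ((hfm hx).1 i) ((g x).1 i).rep_nonzero
        (C := 1) (by simp)
    have hS : ∀ x ∈ U, (f x).2.rep.det ≠ 0 := fun x hx => (hfm hx).2.1
    have hr : ∀ x ∈ U, (toProj (((f x).1 i).rep * ((g x).1 i).rep)).rep * (toProj (f x).2.rep⁻¹).rep ∝
        ((f x).1 i).rep * ((g x).1 i).rep * (f x).2.rep⁻¹ := fun x hx =>
      (toProj_rep (hTA x hx)).mul (toProj_rep (ne_zero_of_det_ne_zero (det_inv_ne_zero (hS x hx))))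
    have hne : ∀ x ∈ U, ((f x).1 i).rep * ((g x).1 i).rep * (f x).2.rep⁻¹ ≠ 0 := fun x hx =>
      mul_mul_ne_zero ((hfm hx).1 i) ((g x).1 i).rep_nonzero (det_inv_ne_zero (hS x hx))
    exact (((hf.fst.eval i).mul (hg.fst.eval i) hTA).mul (hf.snd.inv hS)
      fun x hx => (hr x hx).ne_zero (hne x hx)).congr
        fun x hx => toProj_congr (hr x hx) (hne x hx)
  · exact hf.snd.mulVec (hg.snd.fst.eval j) fun x hx =>
      mulVec_ne_zero (hfm hx).2.1 ((g x).2.1 j).rep_nonzero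
  · exact (hf.fst.eval i).mulVec ((hg.snd.snd.eval i).eval j) fun x hx =>
      mulVec_ne_zero ((hfm hx).1 i) ((g x).2.2 i j).rep_nonzero

/-- The inverse cancels: (T A S⁻¹)(S q) = T(A q). -/
lemma actG_mem_graphSet {g : GAmb m} (hg : g ∈ grpG m) {x : Amb m n}
    (hx : x ∈ graphSet (fun A : P11 => A.rep) m n) :
    actG m n g x ∈ graphSet (fun A : P11 => A.rep) m n := by
  obtain ⟨h1, h2, h3⟩ := rep_actG hg x
  intro i j
  refine represents_iff.mpr (((h1 i).mulVec (h2 j)).trans (.trans ?_ (h3 i j).symm))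
  rw [← Matrix.mulVec_mulVec, inv_mulVec_mulVec hg.2.1, ← Matrix.mulVec_mulVec]
  exact (Proportional.refl _).mulVec (represents_iff.mp (hx i j))

lemma actG_mem_imageCorr {g : GAmb m} (hg : g ∈ grpG m) {x : Amb m n} (hx : x ∈ imageCorr m n) :
    actG m n g x ∈ imageCorr m n := by
  have hc : Continuous (actG m n g) := IsRegularMapOn.continuous
    (isRegularMapOn_actG (.const _ g) (.id _) fun _ _ => hg)
  have hm : MapsTo (actG m n g) (graphSet (fun A : P11 => A.rep) m n)
      (graphSet (fun A : P11 => A.rep) m n) := fun x hx => actG_mem_graphSet hg hx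
  exact hm.closure hc hx

lemma isMorphism_actG {g : GAmb m} (hg : g ∈ grpG m) :
    IsMorphism (imageCorr m n) (imageCorr m n) (actG m n g) :=
  ⟨fun _ hx => actG_mem_imageCorr hg hx, isRegularMapOn_actG (.const _ g) (.id _) fun _ _ => hg⟩

lemma actG_inv_actG {g : GAmb m} (hg : g ∈ grpG m) (x : Amb m n) :
    actG m n (invG m g) (actG m n g x) = x := by
  rw [← actG_mulG (invG_mem hg) hg, (isAlgebraicGroup_grpG m).inv_mul g hg, actG_oneG]

lemma actG_actG_inv {g : GAmb m} (hg : g ∈ grpG m) (x : Amb m n) :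
    actG m n g (actG m n (invG m g) x) = x := by
  have h := actG_inv_actG (invG_mem hg) (actG m n g (actG m n (invG m g) x))
  rwa [actG_inv_actG hg, actG_inv_actG (invG_mem hg), eq_comm] at h

lemma isRationalAction_actG (m n : ℕ) :
    IsRationalAction (grpG m) (mulG m) (oneG m) (imageCorr m n) (actG m n) where
  rational := ⟨_, isDenseOpenIn_self _, fun x hx => actG_mem_imageCorr hx.1 hx.2,
    isRegularMapOn_actG (.fst' _) (.snd' _) fun x hx => hx.1⟩
  birational g hg := by
    refine IsBiregular.isBirational (isVariety_imageCorr m n).2 (isVariety_imageCorr m n).2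
      ⟨isMorphism_actG hg, actG m n (invG m g), isMorphism_actG (invG_mem hg),
        fun x _ => actG_inv_actG hg x, fun x _ => actG_actG_inv hg x⟩
  one_act := Eventually.of_forall actG_oneG
  mul_act g hg h hh := Eventually.of_forall (actG_mulG hg hh)

end Group

/-! ### Normal forms of configurations -/

section NormalForm

variable {m n : ℕ}

/-- The point `[1 : 1 : 1 : 1]`. -/
def E5 : P3 := toProj fun _ => 1

lemma rep_E5 : E5.rep ∝ fun _ => 1 := toProj_rep ones_ne_zero

lemma single_ne_zero {k : ℕ} (j : Fin k) : (Pi.single j 1 : Fin k → ℂ) ≠ 0 := fun h => by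
  simpa using congrFun h j

/-- The images of the coordinate points under a reduced camera. -/
def camFrame : Fin 4 → P2 :=
  Fin.snoc (α := fun _ => P2) (fun j : Fin 3 => toProj (Pi.single j 1)) (toProj fun _ => 1)

lemma rep_camFrame_castSucc (j : Fin 3) : (camFrame j.castSucc).rep ∝ Pi.single j 1 := by
  rw [camFrame, Fin.snoc_castSucc]
  exact toProj_rep (single_ne_zero j)

lemma rep_camFrame_last : (camFrame (Fin.last 3)).rep ∝ fun _ => 1 := by
  rw [camFrame, Fin.snoc_last]
  exact toProj_rep ones_ne_zero

lemma redCam_mulVec_single {a : Fin 4 → ℂ} (ha : ∀ k, a k ≠ 0) (k : Fin 4) :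
    redCam a *ᵥ Pi.single k 1 ∝ (camFrame k).rep := by
  induction k using Fin.lastCases with
  | last =>
    refine .trans ⟨a 3, ha 3, ?_⟩ rep_camFrame_last.symm
    ext i
    rw [Matrix.mulVec_single_one]
    fin_cases i <;> simp [redCam, Fin.last]
  | cast j =>
    refine .trans ⟨a j.castSucc, ha _, ?_⟩ (rep_camFrame_castSucc j).symm
    ext i
    rw [Matrix.mulVec_single_one]
    fin_cases j <;> fin_cases i <;> simp [redCam]

/-- A camera that sends the coordinate points to their images under a reduced camera is reduced. -/
lemma eq_redCam_camParam {A : Matrix (Fin 3) (Fin 4) ℂ}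
    (hA : ∀ k, A *ᵥ Pi.single k 1 ∝ (camFrame k).rep) :
    A = redCam (camParam A) ∧ ∀ k, camParam A k ≠ 0 := by
  -- Up to scalars the first three columns of `A` are the standard basis and the last is (1,1,1),
  -- which is exactly the shape of a reduced camera.
  have h1 : ∀ j : Fin 3, ∃ c : ℂ, c ≠ 0 ∧ ∀ i, A i j.castSucc = c * (Pi.single j 1 : Fin 3 → ℂ) i := by
    intro j
    obtain ⟨c, hc, h⟩ := (hA j.castSucc).trans (rep_camFrame_castSucc j)
    refine ⟨c, hc, fun i => ?_⟩
    simpa using congrFun h i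
  obtain ⟨d, hd, h2⟩ : ∃ d : ℂ, d ≠ 0 ∧ ∀ i, A i 3 = d := by
    obtain ⟨c, hc, h⟩ := (hA (Fin.last 3)).trans rep_camFrame_last
    refine ⟨c, hc, fun i => ?_⟩
    have := congrFun h i
    rw [Matrix.mulVec_single_one] at this
    simpa using this
  obtain ⟨a, ha, h3⟩ := h1 0
  obtain ⟨b, hb, h4⟩ := h1 1
  obtain ⟨c, hc, h5⟩ := h1 2
  simp only [Fin.forall_fin_succ, Fin.castSucc_zero, Fin.castSucc_one] at h2 h3 h4 h5
  simp at h2 h3 h4 h5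
  change A 0 2 = 0 ∧ A 1 2 = 0 ∧ A 2 2 = c at h5
  constructor
  · ext i j
    fin_cases i <;> fin_cases j <;> simp [redCam, camParam, h2, h3, h4, h5]
  · intro k
    fin_cases k <;> simp [camParam, h2, h3, h4, h5, ha, hb, hc, hd]

lemma Proportional.camParam {A B : Matrix (Fin 3) (Fin 4) ℂ} (h : A ∝ B) :
    camParam A ∝ camParam B := by
  obtain ⟨c, hc, rfl⟩ := h
  refine ⟨c, hc, ?_⟩
  ext i
  fin_cases i <;> rfl

lemma Proportional.redCam {a b : Fin 4 → ℂ} (h : a ∝ b) : redCam a ∝ redCam b := by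
  obtain ⟨c, hc, rfl⟩ := h
  refine ⟨c, hc, ?_⟩
  ext i j
  fin_cases i <;> fin_cases j <;> simp [CW.redCam]

/-- The source of the duality: the `i`-th coordinate of A(a)q is a_i q_i + a_4 q_4, which is
symmetric in `a` and `q`. -/
lemma redCam_mulVec_comm (a q : Fin 4 → ℂ) : redCam a *ᵥ q = redCam q *ᵥ a := by
  ext i
  fin_cases i <;>
    simp [redCam, Matrix.mulVec, dotProduct, Fin.sum_univ_four, mul_comm]

lemma redCam_ne_zero {a : Fin 4 → ℂ} (ha : ∀ k, a k ≠ 0) : redCam a ≠ 0 := fun h =>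
  ha 0 (by simpa [redCam] using congrFun (congrFun h 0) 0)

/-- The last four points of a configuration together with `E5`. -/
def pointFrame (x : Amb m (n + 4)) : (Fin 4 → P3) × P3 := (fun k => x.2.1 (Fin.natAdd n k), E5)

/-- The images of the last four points in the camera `i`. -/
def imageFrame (x : Amb m (n + 4)) (i : Fin m) : (Fin 3 → P2) × P2 :=
  (fun j => x.2.2 i (Fin.natAdd n j.castSucc), x.2.2 i (Fin.natAdd n (Fin.last 3)))

/-- The configurations that can be brought to normal form. -/
def regularConf (m n : ℕ) : Set (Amb m (n + 4)) :=
  graphSet (fun A : P11 => A.rep) m (n + 4) ∩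
    {x | pointFrame x ∈ frames 4 ∧ ∀ i, imageFrame x i ∈ frames 3}

/-- The reduced configurations all of whose camera parameters are nonzero. -/
def regularRed (m n : ℕ) : Set (RAmb m n) :=
  graphSet (fun a : P3 => redCam a.rep) m n ∩ {y | ∀ i k, (y.1 i).rep k ≠ 0}

/-- The group element that brings the normal form to the given configuration. -/
def frameElt (x : Amb m (n + 4)) : GAmb m :=
  (fun i => toProj (frameMat (imageFrame x i)), toProj (frameMat (pointFrame x)))

/-- The reduced configuration of a configuration in normal form. -/
def reduce (x : Amb m (n + 4)) : RAmb m n :=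
  (fun i => toProj (camParam (x.1 i).rep), fun j => x.2.1 (Fin.castAdd 4 j),
    fun i j => x.2.2 i (Fin.castAdd 4 j))

/-- The configuration in normal form given by a reduced configuration. -/
def normalForm (y : RAmb m n) : Amb m (n + 4) :=
  (fun i => toProj (redCam (y.1 i).rep), Fin.append y.2.1 (fun k => toProj (Pi.single k 1)),
    fun i => Fin.append (y.2.2 i) camFrame)

lemma rep_frameElt {x : Amb m (n + 4)} (hx : x ∈ regularConf m n) :
    (∀ i, ((frameElt x).1 i).rep ∝ frameMat (imageFrame x i)) ∧
      (frameElt x).2.rep ∝ frameMat (pointFrame x) :=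
  ⟨fun i => toProj_rep (ne_zero_of_det_ne_zero (frameMat_det_ne_zero (hx.2.2 i))),
    toProj_rep (ne_zero_of_det_ne_zero (frameMat_det_ne_zero hx.2.1))⟩

lemma frameElt_mem {x : Amb m (n + 4)} (hx : x ∈ regularConf m n) : frameElt x ∈ grpG m :=
  ⟨fun i => toProj_det_ne_zero (frameMat_det_ne_zero (hx.2.2 i)),
    toProj_mem_stabE5 (frameMat_det_ne_zero hx.2.1) ((frameMat_mulVec_one hx.2.1).trans rep_E5)⟩

/-- A group element times a frame matrix carries the standard frame to the moved frame, so
uniqueness applies. For the frame in ℙ³ this uses that `g` fixes `E5`, which is its fifth point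
before and after the action. -/
lemma frameElt_actG {x : Amb m (n + 4)} (hx : x ∈ regularConf m n) {g : GAmb m}
    (hg : g ∈ grpG m) : actG m (n + 4) g x ∈ regularConf m n ∧
      frameElt (actG m (n + 4) g x) = mulG m g (frameElt x) := by
  obtain ⟨h1, h2, h3⟩ := rep_actG hg x
  obtain ⟨e1, e2⟩ := rep_frameElt hx
  have hq := frameMat_unique (z := pointFrame (actG m (n + 4) g x))
    (A := g.2.rep * frameMat (pointFrame x)) (mul_det_ne_zero hg.2.1 (frameMat_det_ne_zero hx.2.1))
    (fun k => by
      rw [← Matrix.mulVec_mulVec]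
      exact ((Proportional.refl _).mulVec (frameMat_mulVec_single hx.2.1 k)).trans (h2 _).symm)
    (by
      rw [← Matrix.mulVec_mulVec]
      exact ((Proportional.refl _).mulVec ((frameMat_mulVec_one hx.2.1).trans rep_E5)).trans
        ((mem_stabE5_iff.mp hg.2).2.trans rep_E5.symm))
  have hp := fun i => frameMat_unique (z := imageFrame (actG m (n + 4) g x) i)
    (A := (g.1 i).rep * frameMat (imageFrame x i))
    (mul_det_ne_zero (hg.1 i) (frameMat_det_ne_zero (hx.2.2 i)))
    (fun k => by
      rw [← Matrix.mulVec_mulVec]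
      exact ((Proportional.refl _).mulVec (frameMat_mulVec_single (hx.2.2 i) k)).trans (h3 i _).symm)
    (by
      rw [← Matrix.mulVec_mulVec]
      exact ((Proportional.refl _).mulVec (frameMat_mulVec_one (hx.2.2 i))).trans (h3 i _).symm)
  have hmem := frameElt_mem hx
  refine ⟨⟨actG_mem_graphSet hg hx.1, hq.1, fun i => (hp i).1⟩,
    Prod.ext (funext fun i => toProj_congr ?_ ?_) (toProj_congr ?_ ?_)⟩
  · exact (hp i).2.trans ((Proportional.refl _).mul (e1 i).symm)
  · exact ne_zero_of_det_ne_zero (mul_det_ne_zero (hg.1 i) (hmem.1 i))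
  · exact hq.2.trans ((Proportional.refl _).mul e2.symm)
  · exact ne_zero_of_det_ne_zero (mul_det_ne_zero hg.2.1 hmem.2.1)

/-- The identity matrix already carries the standard frames to those of a normal form, so uniqueness
makes the group element trivial. -/
lemma normalForm_mem {y : RAmb m n} (hy : y ∈ regularRed m n) :
    normalForm y ∈ regularConf m n ∧ frameElt (normalForm y) = oneG m ∧
      reduce (normalForm y) = y := by
  have hA : ∀ i, ((normalForm y).1 i).rep ∝ redCam (y.1 i).rep := fun i =>
    toProj_rep (redCam_ne_zero (hy.2 i))
  have hq : ∀ k, ((normalForm y).2.1 (Fin.natAdd n k)).rep ∝ Pi.single k 1 := fun k => by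
    simp only [normalForm, Fin.append_right]
    exact toProj_rep (single_ne_zero k)
  have hp : ∀ i k, (normalForm y).2.2 i (Fin.natAdd n k) = camFrame k := fun i k => by
    simp only [normalForm, Fin.append_right]
  have fq := frameMat_unique (z := pointFrame (normalForm y)) (A := 1) (by simp)
    (fun k => by rw [Matrix.one_mulVec]; exact (hq k).symm)
    (by rw [Matrix.one_mulVec]; exact rep_E5.symm)
  have fp := fun i => frameMat_unique (z := imageFrame (normalForm y) i) (A := 1) (by simp)
    (fun k => by
      rw [Matrix.one_mulVec]
      simp only [imageFrame, hp]
      exact (rep_camFrame_castSucc k).symm)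
    (by
      rw [Matrix.one_mulVec]
      simp only [imageFrame, hp]
      exact rep_camFrame_last.symm)
  refine ⟨⟨fun i j => represents_iff.mpr ?_, fq.1, fun i => (fp i).1⟩, ?_, ?_⟩
  · induction j using Fin.addCases with
    | left j =>
      simp only [normalForm, Fin.append_left]
      exact ((hA i).mulVec (.refl _)).trans (represents_iff.mp (hy.1 i j))
    | right k =>
      rw [hp]
      exact ((hA i).mulVec (hq k)).trans (redCam_mulVec_single (hy.2 i) k)
  · exact Prod.ext (funext fun i => toProj_congr (fp i).2 one_ne_zero)
      (toProj_congr fq.2 one_ne_zero)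
  · refine Prod.ext (funext fun i => toProj_eq ?_) (Prod.ext (funext fun j => ?_)
      (funext fun i => funext fun j => ?_))
    · simpa [camParam_redCam] using (hA i).camParam
    · simp [reduce, normalForm, Fin.append_left]
    · simp [reduce, normalForm, Fin.append_left]

/-- A trivial group element means that the four points and their images are standard, and then
`eq_redCam_camParam` recognizes every camera as reduced. The nonvanishing of the parameters is
recorded because it makes `reduce` regular. -/
lemma reduce_mem {x : Amb m (n + 4)} (hx : x ∈ regularConf m n) (h1 : frameElt x = oneG m) :
    (∀ i k, camParam (x.1 i).rep k ≠ 0) ∧ reduce x ∈ regularRed m n ∧ normalForm (reduce x) = x := by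
  obtain ⟨e1, e2⟩ := rep_frameElt hx
  obtain ⟨o1, o2⟩ := rep_oneG m
  rw [h1] at e1 e2
  have hq : ∀ k, (x.2.1 (Fin.natAdd n k)).rep ∝ Pi.single k 1 := fun k => by
    have := (e2.symm.trans o2).mulVec (.refl (Pi.single k 1))
    rw [Matrix.one_mulVec] at this
    exact (frameMat_mulVec_single hx.2.1 k).symm.trans this
  have hp : ∀ i k, (x.2.2 i (Fin.natAdd n k)).rep ∝ (camFrame k).rep := fun i k => by
    induction k using Fin.lastCases with
    | last =>
      have := ((e1 i).symm.trans (o1 i)).mulVec (.refl fun _ => 1)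
      rw [Matrix.one_mulVec] at this
      exact ((frameMat_mulVec_one (hx.2.2 i)).symm.trans this).trans rep_camFrame_last.symm
    | cast j =>
      have := ((e1 i).symm.trans (o1 i)).mulVec (.refl (Pi.single j 1))
      rw [Matrix.one_mulVec] at this
      exact ((frameMat_mulVec_single (hx.2.2 i) j).symm.trans this).trans
        (rep_camFrame_castSucc j).symm
  have hA := fun i => eq_redCam_camParam (A := (x.1 i).rep) fun k =>
    ((Proportional.refl _).mulVec (hq k).symm).trans
      ((represents_iff.mp (hx.1 i (Fin.natAdd n k))).trans (hp i k))
  have hne : ∀ i, camParam (x.1 i).rep ≠ 0 := fun i h => (hA i).2 0 (congrFun h 0)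
  have hred : ∀ i, ((reduce x).1 i).rep ∝ camParam (x.1 i).rep := fun i => toProj_rep (hne i)
  have hcam : ∀ i, redCam ((reduce x).1 i).rep ∝ (x.1 i).rep := fun i => by
    have := (hred i).redCam
    rwa [← (hA i).1] at this
  have hmem : reduce x ∈ regularRed m n := by
    refine ⟨fun i j => represents_iff.mpr ?_, fun i k => ?_⟩
    · exact ((hcam i).mulVec (.refl _)).trans (represents_iff.mp (hx.1 i (Fin.castAdd 4 j)))
    · obtain ⟨c, hc, h⟩ := hred i
      rw [h]
      exact mul_ne_zero hc ((hA i).2 k)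
  refine ⟨fun i => (hA i).2, hmem, eq_of_rep (fun i => ?_) (fun j => ?_) fun i j => ?_⟩
  · exact (toProj_rep (redCam_ne_zero (hmem.2 i))).trans (hcam i)
  · induction j using Fin.addCases with
    | left j =>
      simp only [normalForm, Fin.append_left]
      exact .refl _
    | right k =>
      simp only [normalForm, Fin.append_right]
      exact (toProj_rep (single_ne_zero k)).trans (hq k).symm
  · induction j using Fin.addCases with
    | left j =>
      simp only [normalForm, Fin.append_left]
      exact .refl _
    | right k =>
      simp only [normalForm, Fin.append_right]
      exact (hp i k).symm

/-! ### The birational equivalence -/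

/-- The reduced configuration and the group element of a configuration. -/
def splitConf (m n : ℕ) (x : Amb m (n + 4)) : RAmb m n × GAmb m :=
  (reduce (actG m (n + 4) (invG m (frameElt x)) x), frameElt x)

/-- The configuration with given reduced configuration and group element. -/
def joinConf (m n : ℕ) (z : RAmb m n × GAmb m) : Amb m (n + 4) :=
  actG m (n + 4) z.2 (normalForm z.1)

lemma mulG_oneG {g : GAmb m} : mulG m g (oneG m) = g := by
  refine Prod.ext (funext fun i => toProj_eq ?_) (toProj_eq ?_)
  · simpa using (Proportional.refl (g.1 i).rep).mul ((rep_oneG m).1 i)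
  · simpa using (Proportional.refl g.2.rep).mul (rep_oneG m).2

/-- By equivariance, the group element of g⁻¹x is g⁻¹g = 1 when `g` is that of `x`. -/
lemma frameElt_inv_actG {x : Amb m (n + 4)} (hx : x ∈ regularConf m n) :
    actG m (n + 4) (invG m (frameElt x)) x ∈ regularConf m n ∧
      frameElt (actG m (n + 4) (invG m (frameElt x)) x) = oneG m := by
  have hg := frameElt_mem hx
  obtain ⟨h1, h2⟩ := frameElt_actG hx (invG_mem hg)
  exact ⟨h1, h2.trans ((isAlgebraicGroup_grpG m).inv_mul _ hg)⟩

lemma mapsTo_splitConf : MapsTo (splitConf m n) (regularConf m n) (regularRed m n ×ˢ grpG m) :=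
  fun _ hx => ⟨(reduce_mem (frameElt_inv_actG hx).1 (frameElt_inv_actG hx).2).2.1, frameElt_mem hx⟩

lemma mapsTo_joinConf : MapsTo (joinConf m n) (regularRed m n ×ˢ grpG m) (regularConf m n) :=
  fun _ hz => (frameElt_actG (normalForm_mem hz.1).1 hz.2).1

lemma joinConf_splitConf {x : Amb m (n + 4)} (hx : x ∈ regularConf m n) :
    joinConf m n (splitConf m n x) = x := by
  simp only [joinConf, splitConf]
  rw [(reduce_mem (frameElt_inv_actG hx).1 (frameElt_inv_actG hx).2).2.2,
    actG_actG_inv (frameElt_mem hx)]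

lemma splitConf_joinConf {z : RAmb m n × GAmb m} (hz : z ∈ regularRed m n ×ˢ grpG m) :
    splitConf m n (joinConf m n z) = z := by
  obtain ⟨h1, h2, h3⟩ := normalForm_mem hz.1
  have h4 : frameElt (joinConf m n z) = z.2 := by
    rw [joinConf, (frameElt_actG h1 hz.2).2, h2, mulG_oneG]
  refine Prod.ext ?_ h4
  simp only [splitConf, h4]
  rw [joinConf, actG_inv_actG hz.2, h3]

/-- In product coordinates the action is left translation on the group factor; the quotient
statement rests on this. -/
lemma actG_joinConf {z : RAmb m n × GAmb m} (hz : z ∈ regularRed m n ×ˢ grpG m) {g : GAmb m}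
    (hg : g ∈ grpG m) : actG m (n + 4) g (joinConf m n z) = joinConf m n (z.1, mulG m g z.2) := by
  simp only [joinConf]
  rw [actG_mulG hg hz.2]

lemma isRegularMapOn_splitConf : IsRegularMapOn (regularConf m n) (splitConf m n) := by
  have hq : ∀ k, IsRegularMapOn (regularConf m n) (fun x => x.2.1 k) := fun k =>
    (IsRegularMapOn.snd' _).fst.eval k
  have hp : ∀ i k, IsRegularMapOn (regularConf m n) (fun x => x.2.2 i k) := fun i k =>
    ((IsRegularMapOn.snd' _).snd.eval i).eval k
  have hf : IsRegularMapOn (regularConf m n) (frameElt (m := m) (n := n)) :=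
    .prodMk (.pi fun i => .frame (.pi fun j => hp i _) (hp i _) fun x hx => hx.2.2 i)
      (.frame (.pi fun k => hq _) (.const _ E5) fun x hx => hx.2.1)
  have hfm : MapsTo (frameElt (m := m) (n := n)) (regularConf m n) (grpG m) :=
    fun x hx => frameElt_mem hx
  have hinv := (isAlgebraicGroup_grpG m).inv_morphism
  have hact : IsRegularMapOn (regularConf m n)
      (fun x => actG m (n + 4) (invG m (frameElt x)) x) :=
    isRegularMapOn_actG (hinv.2.comp hf hfm) (.id _) (hinv.1.comp hfm)
  refine .prodMk (.prodMk (.pi fun i => ?_) (.prodMk (.pi fun j => ?_)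
    (.pi fun i => .pi fun j => ?_))) hf
  · exact (hact.fst.eval i).camParam fun x hx h =>
      (reduce_mem (frameElt_inv_actG hx).1 (frameElt_inv_actG hx).2).1 i 0 (congrFun h 0)
  · exact hact.snd.fst.eval _
  · exact (hact.snd.snd.eval i).eval _

lemma isRegularMapOn_joinConf : IsRegularMapOn (regularRed m n ×ˢ grpG m) (joinConf m n) := by
  refine isRegularMapOn_actG (.snd' _) (.prodMk (.pi fun i => ?_) (.prodMk (.pi fun j => ?_)
    (.pi fun i => .pi fun j => ?_))) fun _ hz => hz.2
  · exact ((IsRegularMapOn.fst' _).fst.eval i).redCam fun _ hz => redCam_ne_zero (hz.1.2 i)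
  · induction j using Fin.addCases with
    | left j =>
      simp only [Fin.append_left]
      exact (IsRegularMapOn.fst' _).snd.fst.eval j
    | right k =>
      simp only [Fin.append_right]
      exact .const _ _
  · induction j using Fin.addCases with
    | left j =>
      simp only [Fin.append_left]
      exact ((IsRegularMapOn.fst' _).snd.snd.eval i).eval j
    | right k =>
      simp only [Fin.append_right]
      exact .const _ _

/-! ### Density of the regular loci -/

lemma regularRed_nonempty (m n : ℕ) : (regularRed m n).Nonempty := by
  have h1 : redCam E5.rep *ᵥ E5.rep ≠ 0 := by
    refine (rep_E5.redCam.mulVec rep_E5).ne_zero fun h => ?_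
    simpa [redCam, Matrix.mulVec, dotProduct, Fin.sum_univ_four] using congrFun h 0
  -- All cameras and points are taken at `E5`; up to scalars every image is (2,2,2).
  refine ⟨(fun _ => E5, fun _ => E5, fun _ _ => toProj (redCam E5.rep *ᵥ E5.rep)),
    fun i j => represents_toProj h1, fun i k => ?_⟩
  obtain ⟨c, hc, h⟩ := rep_E5
  change E5.rep k ≠ 0
  simp [h, hc]

lemma isOpen_forall_rep_ne_zero (m n : ℕ) : IsOpen {y : RAmb m n | ∀ i k, (y.1 i).rep k ≠ 0} := by
  have h : ∀ i k, IsOpen ((fun y : RAmb m n => y.1 i) ⁻¹' {a | a.rep k ≠ 0}) := fun i k =>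
    (isForm_vec k).isOpen_ne.preimage ((IsRegularMapOn.fst' univ).eval i).continuous
  convert isOpen_iInter_of_finite fun i => isOpen_iInter_of_finite (h i) using 1
  ext y
  simp

lemma isDenseOpenIn_regularRed (m n : ℕ) : IsDenseOpenIn (redCorr m n) (regularRed m n) := by
  have hsub : graphSet (fun a : P3 => redCam a.rep) m n ⊆ redCorr m n := subset_closure
  have hg : IsDenseOpenIn (redCorr m n) (graphSet (fun a : P3 => redCam a.rep) m n) :=
    isDenseOpenIn_graphSet (β := fun a : P3 => redCam a.rep) isForm_redCam
  have hd : IsDenseOpenIn (redCorr m n) (redCorr m n ∩ {y | ∀ i k, (y.1 i).rep k ≠ 0}) := by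
    obtain ⟨y, hy⟩ := regularRed_nonempty m n
    exact (isDenseOpenIn_iff (isVariety_redCorr m n).2).mpr
      ⟨⟨_, isOpen_forall_rep_ne_zero m n, rfl⟩, y, hsub hy.1, hy.2⟩
  have heq : regularRed m n = graphSet (fun a : P3 => redCam a.rep) m n ∩
      (redCorr m n ∩ {y | ∀ i k, (y.1 i).rep k ≠ 0}) :=
    Subset.antisymm (fun z hz => ⟨hz.1, hsub hz.1, hz.2⟩) (fun z hz => ⟨hz.1, hz.2.2⟩)
  rw [heq]
  exact hg.inter hd

lemma isDenseOpenIn_regularConf (m n : ℕ) :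
    IsDenseOpenIn (imageCorr m (n + 4)) (regularConf m n) := by
  have hq : ∀ k, IsRegularMapOn univ (fun x : Amb m (n + 4) => x.2.1 k) := fun k =>
    (IsRegularMapOn.snd' _).fst.eval k
  have hp : ∀ i k, IsRegularMapOn univ (fun x : Amb m (n + 4) => x.2.2 i k) := fun i k =>
    ((IsRegularMapOn.snd' _).snd.eval i).eval k
  have ho : IsOpen {x : Amb m (n + 4) | pointFrame x ∈ frames 4 ∧ ∀ i, imageFrame x i ∈ frames 3} := by
    have h1 : IsOpen {x : Amb m (n + 4) | pointFrame x ∈ frames 4} := isOpen_frames.preimage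
      (IsRegularMapOn.prodMk (.pi fun k => hq _) (.const _ E5)).continuous
    have h2 : ∀ i, IsOpen {x : Amb m (n + 4) | imageFrame x i ∈ frames 3} := fun i =>
      isOpen_frames.preimage (IsRegularMapOn.prodMk (.pi fun k => hp i _) (hp i _)).continuous
    convert h1.inter (isOpen_iInter_of_finite h2) using 1
    ext x
    simp
  have hsub : graphSet (fun A : P11 => A.rep) m (n + 4) ⊆ imageCorr m (n + 4) := subset_closure
  -- A normal form is the witness that the general position conditions can be met.
  obtain ⟨y, hy⟩ := regularRed_nonempty m n
  have hx := (normalForm_mem hy).1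
  have hd : IsDenseOpenIn (imageCorr m (n + 4)) (imageCorr m (n + 4) ∩ _) :=
    (isDenseOpenIn_iff (isVariety_imageCorr m (n + 4)).2).mpr
      ⟨⟨_, ho, rfl⟩, normalForm y, hsub hx.1, hx.2⟩
  have hg : IsDenseOpenIn (imageCorr m (n + 4)) (graphSet (fun A : P11 => A.rep) m (n + 4)) :=
    isDenseOpenIn_graphSet isForm_mat
  convert hg.inter hd using 1
  ext z
  exact ⟨fun hz => ⟨hz.1, hsub hz.1, hz.2⟩, fun hz => ⟨hz.1, hz.2.2⟩⟩

lemma isBirational_splitConf (m n : ℕ) :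
    IsBirational (imageCorr m (n + 4)) (redCorr m n ×ˢ grpG m) (splitConf m n) :=
  isBirational_of_inverse (isVariety_imageCorr m (n + 4)).2
    (isIrreducible_prod (isVariety_redCorr m n).2 (isIrreducible_grpG m))
    (isDenseOpenIn_regularConf m n)
    (isDenseOpenIn_prod (isVariety_redCorr m n).2 (isIrreducible_grpG m)
      (isDenseOpenIn_regularRed m n) (isDenseOpenIn_self _))
    isRegularMapOn_splitConf mapsTo_splitConf isRegularMapOn_joinConf mapsTo_joinConf
    (fun _ => joinConf_splitConf) (fun _ => splitConf_joinConf)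

lemma isIrreducible_top (m n k : ℕ) : IsIrreducible (imageCorr m n ×ˢ PGLPow k) :=
  isIrreducible_prod (isVariety_imageCorr m n).2 (isIrreducible_PGLPow k)

lemma isIrreducible_mid (m n k : ℕ) : IsIrreducible ((redCorr m n ×ˢ grpG m) ×ˢ PGLPow k) :=
  isIrreducible_prod (isIrreducible_prod (isVariety_redCorr m n).2 (isIrreducible_grpG m))
    (isIrreducible_PGLPow k)

lemma isDenseOpenIn_top (m n k : ℕ) :
    IsDenseOpenIn (imageCorr m (n + 4) ×ˢ PGLPow k) (regularConf m n ×ˢ PGLPow k) :=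
  isDenseOpenIn_prod (isVariety_imageCorr m (n + 4)).2 (isIrreducible_PGLPow k)
    (isDenseOpenIn_regularConf m n) (isDenseOpenIn_self _)

lemma isDenseOpenIn_mid (m n k : ℕ) :
    IsDenseOpenIn ((redCorr m n ×ˢ grpG m) ×ˢ PGLPow k)
      ((regularRed m n ×ˢ grpG m) ×ˢ PGLPow k) :=
  isDenseOpenIn_prod (isIrreducible_prod (isVariety_redCorr m n).2 (isIrreducible_grpG m))
    (isIrreducible_PGLPow k)
    (isDenseOpenIn_prod (isVariety_redCorr m n).2 (isIrreducible_grpG m)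
      (isDenseOpenIn_regularRed m n) (isDenseOpenIn_self _)) (isDenseOpenIn_self _)

lemma isRegularMapOn_prodMap_id {M N K : Type} [MultiProj M] [MultiProj N] [MultiProj K]
    {U : Set M} {V : Set K} {f : M → N} (hf : IsRegularMapOn U f) :
    IsRegularMapOn (U ×ˢ V) (Prod.map f id) :=
  (hf.comp (IsRegularMapOn.fst' (U ×ˢ V)) fun _ hz => hz.1).prodMk (.snd' _)

lemma isBirational_splitConf_prod (m n k : ℕ) :
    IsBirational (imageCorr m (n + 4) ×ˢ PGLPow k) ((redCorr m n ×ˢ grpG m) ×ˢ PGLPow k)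
      (Prod.map (splitConf m n) id) :=
  isBirational_of_inverse (g := Prod.map (joinConf m n) id)
    (isIrreducible_top _ _ _) (isIrreducible_mid _ _ _)
    (isDenseOpenIn_top m n k) (isDenseOpenIn_mid m n k)
    (isRegularMapOn_prodMap_id isRegularMapOn_splitConf) (mapsTo_splitConf.prodMap (mapsTo_id _))
    (isRegularMapOn_prodMap_id isRegularMapOn_joinConf) (mapsTo_joinConf.prodMap (mapsTo_id _))
    (fun _ hz => Prod.ext (joinConf_splitConf hz.1) rfl)
    (fun _ hz => Prod.ext (splitConf_joinConf hz.1) rfl)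

lemma isBirational_joinConf_prod (m n k : ℕ) :
    IsBirational ((redCorr m n ×ˢ grpG m) ×ˢ PGLPow k) (imageCorr m (n + 4) ×ˢ PGLPow k)
      (Prod.map (joinConf m n) id) :=
  isBirational_of_inverse (g := Prod.map (splitConf m n) id)
    (isIrreducible_mid _ _ _) (isIrreducible_top _ _ _)
    (isDenseOpenIn_mid m n k) (isDenseOpenIn_top m n k)
    (isRegularMapOn_prodMap_id isRegularMapOn_joinConf) (mapsTo_joinConf.prodMap (mapsTo_id _))
    (isRegularMapOn_prodMap_id isRegularMapOn_splitConf) (mapsTo_splitConf.prodMap (mapsTo_id _))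
    (fun _ hz => Prod.ext (splitConf_joinConf hz.1) rfl)
    (fun _ hz => Prod.ext (joinConf_splitConf hz.1) rfl)

/-! ### The rational quotient -/

lemma isRationalQuotient_splitConf (m n : ℕ) :
    IsRationalQuotient (grpG m) (mulG m) (invG m) (oneG m) (imageCorr m (n + 4)) (actG m (n + 4))
      (redCorr m n) (fun x => (splitConf m n x).1) := by
  refine isRationalQuotient_of_sections (isAlgebraicGroup_grpG m) (isVariety_imageCorr m (n + 4))
    (isVariety_redCorr m n) (isRationalAction_actG m (n + 4)) (fun g hg => isMorphism_actG hg)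
    (isDenseOpenIn_regularConf m n) (isDenseOpenIn_regularRed m n) isRegularMapOn_splitConf.fst
    (fun x hx => (mapsTo_splitConf hx).1) ?_ ?_ ?_
  · intro g hg x hx
    have h := mapsTo_splitConf hx
    have h' := actG_joinConf h hg
    rw [joinConf_splitConf hx] at h'
    have hz : ((splitConf m n x).1, mulG m g (splitConf m n x).2) ∈ regularRed m n ×ˢ grpG m :=
      ⟨h.1, mulG_mem hg h.2⟩
    rw [h', splitConf_joinConf hz]
  · intro x hx x' hx' heq
    have h := mapsTo_splitConf hx
    have h' := mapsTo_splitConf hx'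
    have hxn : actG m (n + 4) (invG m (splitConf m n x).2) x = normalForm (splitConf m n x).1 := by
      have := actG_inv_actG h.2 (normalForm (splitConf m n x).1)
      rwa [show actG m (n + 4) (splitConf m n x).2 (normalForm (splitConf m n x).1) = x from
        joinConf_splitConf hx] at this
    -- The inverse of the first group coordinate brings `x` to the common normal form, and the
    -- second one brings that to `x'`.
    refine ⟨mulG m (splitConf m n x').2 (invG m (splitConf m n x).2),
      mulG_mem h'.2 (invG_mem h.2), ?_⟩
    rw [actG_mulG h'.2 (invG_mem h.2), hxn, heq]
    exact joinConf_splitConf hx'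
  · intro x hx
    have h := mapsTo_splitConf hx
    -- The section through `x` keeps the group coordinate of `x` fixed.
    have hm : MapsTo (fun y : RAmb m n => (y, (splitConf m n x).2)) (regularRed m n)
        (regularRed m n ×ˢ grpG m) := fun y hy => ⟨hy, h.2⟩
    refine ⟨fun y => joinConf m n (y, (splitConf m n x).2), ?_, mapsTo_joinConf.comp hm, fun y hy => ?_,
      joinConf_splitConf hx⟩
    · exact (isRegularMapOn_joinConf.comp ((IsRegularMapOn.id _).prodMk (.const _ _)) hm :)
    · simp only [splitConf_joinConf (hm hy)]

/-! ### The swap -/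

lemma isRegularMapOn_swapRed (U : Set (RAmb m n)) : IsRegularMapOn U (swapRed m n) :=
  .prodMk (IsRegularMapOn.snd' _).fst (.prodMk (.fst' _)
    (.pi fun j => .pi fun i => ((IsRegularMapOn.snd' _).snd.eval i).eval j))

lemma isMorphism_swapRed (m n : ℕ) : IsMorphism (redCorr m n) (redCorr n m) (swapRed m n) := by
  have hm : MapsTo (swapRed m n) (graphSet (fun a : P3 => redCam a.rep) m n)
      (graphSet (fun a : P3 => redCam a.rep) n m) := fun x hx j i => by
    have := hx i j
    rwa [redCam_mulVec_comm] at this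
  exact ⟨hm.closure (isRegularMapOn_swapRed univ).continuous, isRegularMapOn_swapRed _⟩

lemma isBiregular_swapRed (m n : ℕ) : IsBiregular (redCorr m n) (redCorr n m) (swapRed m n) :=
  ⟨isMorphism_swapRed m n, swapRed n m, isMorphism_swapRed n m, fun _ _ => rfl, fun _ _ => rfl⟩

lemma isMorphism_swapMid (m n : ℕ) :
    IsMorphism ((redCorr m n ×ˢ grpG m) ×ˢ PGLPow n) ((redCorr n m ×ˢ grpG n) ×ˢ PGLPow m)
      (swapMid m n) := by
  refine ⟨fun z hz => ⟨⟨(isMorphism_swapRed m n).1 hz.1.1, hz.2, hz.1.2.2⟩, hz.1.2.1⟩, ?_⟩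
  have h1 := IsRegularMapOn.fst' ((redCorr m n ×ˢ grpG m) ×ˢ PGLPow n)
  have h2 := (isRegularMapOn_swapRed univ).comp h1.fst (mapsTo_univ _ _)
  exact (h2.prodMk ((IsRegularMapOn.snd' _).prodMk h1.snd.snd)).prodMk h1.snd.fst

lemma isBirational_swapMid (m n : ℕ) :
    IsBirational ((redCorr m n ×ˢ grpG m) ×ˢ PGLPow n) ((redCorr n m ×ˢ grpG n) ×ˢ PGLPow m)
      (swapMid m n) :=
  IsBiregular.isBirational (isIrreducible_mid _ _ _) (isIrreducible_mid _ _ _)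
    ⟨isMorphism_swapMid m n, swapMid n m, isMorphism_swapMid n m, fun _ _ => rfl, fun _ _ => rfl⟩

/-- The duality of configurations. -/
def swapConf (m n : ℕ) (z : Amb m (n + 4) × (Fin n → PMat 3)) :
    Amb n (m + 4) × (Fin m → PMat 3) :=
  Prod.map (joinConf n m) id (swapMid m n (Prod.map (splitConf m n) id z))

lemma isBirational_swapConf (m n : ℕ) :
    IsBirational (imageCorr m (n + 4) ×ˢ PGLPow n) (imageCorr n (m + 4) ×ˢ PGLPow m)
      (swapConf m n) := by
  have h := (isBirational_swapMid m n).comp (isIrreducible_top _ _ _) (isIrreducible_mid _ _ _)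
    (isBirational_splitConf_prod m n n)
  exact ((isBirational_joinConf_prod n m m).comp (isIrreducible_top _ _ _)
    (isIrreducible_top _ _ _) h :)

/-- The square commutes wherever the swapped triple lies in the regular locus of the dual side,
which also requires the coordinates of the original points to be nonzero. This holds generically
because the composite into the middle row is dominant. -/
lemma splitConf_swapConf (m n : ℕ) :
    ∀ᶠ z in gen (imageCorr m (n + 4) ×ˢ PGLPow n),
      Prod.map (splitConf n m) id (swapConf m n z) = swapMid m n (Prod.map (splitConf m n) id z) := by
  have h := ((isBirational_swapMid m n).1.2.comp (isBirational_splitConf_prod m n n).1.2).eventually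
    (isDenseOpenIn_mid n m m).mem_gen
  filter_upwards [h] with z hz
  exact Prod.ext (splitConf_joinConf hz.1) rfl

lemma swapConf_swapConf (m n : ℕ) :
    ∀ᶠ z in gen (imageCorr m (n + 4) ×ˢ PGLPow n), swapConf n m (swapConf m n z) = z := by
  filter_upwards [splitConf_swapConf m n, (isDenseOpenIn_top m n n).mem_gen] with z hz hzU
  -- The inner split and join cancel by commutativity of the square, and the two middle swaps cancel
  -- by definition.
  rw [swapConf, hz]
  exact Prod.ext (joinConf_splitConf hzU.1) rfl

end NormalForm

end CW

end

theorem mainTheorem3 :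
    -- the vertical birational maps `Φ m n` and the horizontal maps `top m n` of the top square
    ∃ (Φ : ∀ m n : ℕ, CW.Amb m (n + 4) → CW.RAmb m n × CW.GAmb m)
      (top : ∀ m n : ℕ, CW.Amb m (n + 4) × (Fin n → CW.PMat 3) →
        CW.Amb n (m + 4) × (Fin m → CW.PMat 3)),
      ∀ m n : ℕ,
        -- the birational equivalence of varieties
        CW.IsVariety (CW.imageCorr m (n + 4)) ∧
        CW.IsVariety (CW.redCorr m n) ∧
        CW.IsVariety (CW.grpG m) ∧
        CW.IsBirational (CW.imageCorr m (n + 4)) (CW.redCorr m n ×ˢ CW.grpG m) (Φ m n) ∧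
        -- the arrows of the diagram
        CW.IsBirational (CW.imageCorr m (n + 4) ×ˢ CW.PGLPow n)
          ((CW.redCorr m n ×ˢ CW.grpG m) ×ˢ CW.PGLPow n) (Prod.map (Φ m n) id) ∧
        CW.IsBirational (CW.imageCorr m (n + 4) ×ˢ CW.PGLPow n)
          (CW.imageCorr n (m + 4) ×ˢ CW.PGLPow m) (top m n) ∧
        CW.IsBirational ((CW.redCorr m n ×ˢ CW.grpG m) ×ˢ CW.PGLPow n)
          ((CW.redCorr n m ×ˢ CW.grpG n) ×ˢ CW.PGLPow m) (CW.swapMid m n) ∧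
        CW.IsBiregular (CW.redCorr m n) (CW.redCorr n m) (CW.swapRed m n) ∧
        -- the two squares commute
        (∀ᶠ z in CW.gen (CW.imageCorr m (n + 4) ×ˢ CW.PGLPow n),
          Prod.map (Φ n m) id (top m n z) = CW.swapMid m n (Prod.map (Φ m n) id z)) ∧
        (∀ z ∈ (CW.redCorr m n ×ˢ CW.grpG m) ×ˢ CW.PGLPow n,
          (CW.swapMid m n z).1.1 = CW.swapRed m n z.1.1) ∧
        -- the horizontal maps are mutually inverse
        CW.CompEqIdWhereDefined (CW.imageCorr m (n + 4) ×ˢ CW.PGLPow n)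
          (CW.imageCorr n (m + 4) ×ˢ CW.PGLPow m) (top m n) (top n m) ∧
        (∀ z ∈ (CW.redCorr m n ×ˢ CW.grpG m) ×ˢ CW.PGLPow n,
          CW.swapMid n m (CW.swapMid m n z) = z) ∧
        (∀ x ∈ CW.redCorr m n, CW.swapRed n m (CW.swapRed m n x) = x) ∧
        -- the vertical maps are rational quotients
        CW.IsRationalQuotient (CW.grpG m) (CW.mulG m) (CW.invG m) (CW.oneG m)
          (CW.imageCorr m (n + 4)) (CW.actG m (n + 4)) (CW.redCorr m n)
          (fun x => (Φ m n x).1) ∧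
        -- compatibility with the projections
        (∀ x ∈ CW.redCorr m n, CW.forgetQ n m (CW.swapRed m n x) =
          CW.transposeImg n m n (CW.forgetA m n x)) ∧
        (∀ x ∈ CW.redCorr m n, CW.forgetA n m (CW.swapRed m n x) =
          CW.transposeImg m m n (CW.forgetQ m n x)) := by

  refine ⟨CW.splitConf, CW.swapConf, fun m n => ⟨CW.isVariety_imageCorr m (n + 4),
    CW.isVariety_redCorr m n, CW.isVariety_grpG m, CW.isBirational_splitConf m n,
    CW.isBirational_splitConf_prod m n n, CW.isBirational_swapConf m n, CW.isBirational_swapMid m n,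
    CW.isBiregular_swapRed m n, CW.splitConf_swapConf m n, fun _ _ => rfl,
    CW.compEqIdWhereDefined_of_eventually (CW.isIrreducible_top _ _ _)
      (CW.isBirational_swapConf m n).1.2 (CW.swapConf_swapConf m n),
    fun _ _ => rfl, fun _ _ => rfl, CW.isRationalQuotient_splitConf m n, fun _ _ => rfl,
    fun _ _ => rfl⟩⟩
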